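/- Let $\mathbb T$ be the unit circle with normalized Lebesgue measure, $L^p=L^p(\mathbb T)$, let $H^2\subset L^2$ be the Hardy space, $H^2_-=L^2\ominus H^2$, $H^\infty=H^2\cap L^\infty$, and let $P^+$, $P^-$ be the orthogonal projections of $L^2$ onto $H^2$, $H^2_-$. For an inner function $\theta$ put $K_\theta=H^2\ominus\theta H^2$ and $K_\theta^\perp=L^2\ominus K_\theta=\theta H^2\oplus H^2_-$, and let $D_z^\theta$ be the bounded operator on $K_\theta^\perp$ given by $D_z^\theta f=P_{K_\theta^\perp}(zf)$, where $P_X$ denotes the orthogonal projection of $L^2$ onto a closed subspace $X$. For inner functions $\theta,\alpha$ and $\varphi\in L^2$ define, on the bounded functions in $\theta H^2$ and in $H^2_-$ respectively, $$\hat T_\varphi^{\theta,\alpha}f=P_{\alpha H^2}(\varphi f),\quad \hat\Gamma_\varphi^{\theta}f=P^-(\varphi f)\quad (f\in\theta H^2\cap L^\infty),$$ $$\check\Gamma_\varphi^{\alpha}f=P_{\alpha H^2}(\varphi f),\quad \check T_\varphi f=P^-(\varphi f)\quad (f\in H^2_-\cap L^\infty).$$ **Theorem.** Let $\alpha,\theta$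 be nonconstant inner functions and let $D:K_\theta^\perp\to K_\alpha^\perp$ be a bounded linear operator. Then $DD_z^\theta=D_z^\alpha D$ if and only if there are $\psi_1,\psi_2,\psi_3,\psi_4\in L^2$ such that, with respect to the decompositions $K_\theta^\perp=\theta H^2\oplus H^2_-$ and $K_\alpha^\perp=\alpha H^2\oplus H^2_-$, $$D=\begin{bmatrix}\hat T_{\psi_1}^{\theta,\alpha}&\check\Gamma_{\psi_2}^{\alpha}\\ \hat\Gamma_{\psi_3}^{\theta}&\check T_{\psi_4}\end{bmatrix}$$ (that is, each entry of the matrix of $D$ agrees with the indicated operator on the bounded functions in its domain space) and the following conditions hold: 1. if $\theta(0)\neq0$, then $\psi_1=\frac{\overline{\alpha(0)}}{\overline{\theta(0)}}\,\alpha\bar\theta\,\psi_4$, $\ \psi_2=\overline{\alpha(0)}\,\alpha P^+(\psi_4)$, $\ \psi_3=\frac1{\overline{\theta(0)}}\,\bar\theta\,P^-(\psi_4)$, $\ \psi_4\in L^\infty$; 2. if $\theta(0)=0$ and $\alpha(0)\neq0$, then $\psi_1\in L^\infty$, $\ \psi_2=0$, $\ \psi_3=\frac1{\overline{\alpha(0)}}\,\bar\theta\,P^-(\bar\alpha\theta\psi_1)$,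 $\ \psi_4=0$; 3. if $\theta(0)=\alpha(0)=0$, then $\psi_1\in\alpha\bar\theta H^\infty$, $\ \psi_2=0$, $\ \psi_3\in L^\infty$, $\ \psi_4\in H^\infty$. -/

import Mathlib

open MeasureTheory AddCircle
open scoped ENNReal ComplexConjugate

noncomputable section

namespace DualTruncated

/-- Normalized Lebesgue measure `m` on the unit circle. The circle is `ℝ/ℤ`, with `t` standing for
the point `e^{2πit}`; the monomial `z ^ n` is `fourier n`. -/
abbrev circleMeasure : Measure UnitAddCircle := haarAddCircle

/-- The space `L²` of the unit circle. -/
abbrev L2 : Type := Lp ℂ 2 circleMeasure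

/-- The space `L^∞` of the unit circle. -/
abbrev Linf : Type := Lp ℂ ∞ circleMeasure

theorem fourierCoeff_L2 (f : L2) (n : ℤ) : fourierCoeff f n = fourierBasis.repr f n :=
  (fourierBasis_repr f n).symm

/-- The Hardy space `H²`: the functions in `L²` whose Fourier coefficients of negative index
vanish, i.e. those which extend holomorphically to the unit disk. -/
def hardy : Submodule ℂ L2 where
  carrier := {f | ∀ n : ℤ, n < 0 → fourierCoeff f n = 0}
  add_mem' := by
    intro f g hf hg n hn
    have h1 := hf n hn
    have h2 := hg n hn
    rw [fourierCoeff_L2] at h1 h2 ⊢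
    simp [h1, h2]
  zero_mem' := by
    intro n _
    rw [fourierCoeff_L2]
    simp
  smul_mem' := by
    intro c f hf n hn
    have h1 := hf n hn
    rw [fourierCoeff_L2] at h1 ⊢
    simp [h1]

theorem isClosed_hardy : IsClosed (hardy : Set L2) := by
  have h : (hardy : Set L2) = ⋂ (n : ℤ) (_ : n < 0),
      {f : L2 | inner ℂ (fourierBasis (T := 1) n) f = (0 : ℂ)} := by
    ext f
    simp only [Set.mem_iInter, Set.mem_ofPred_eq]
    refine forall₂_congr fun n _ => ?_
    rw [fourierCoeff_L2, HilbertBasis.repr_apply_apply]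
  rw [h]
  exact isClosed_iInter fun n => isClosed_iInter fun _ =>
    isClosed_eq (continuous_const.inner continuous_id) continuous_const

instance : CompleteSpace hardy := isClosed_hardy.completeSpace_coe

/-- The bounded functions in `L²`, i.e. `L^∞` seen as a subspace of `L²`. -/
def bdd : Submodule ℂ L2 where
  carrier := {f | MemLp f ∞ circleMeasure}
  add_mem' := fun {f g} hf hg => (hf.add hg).ae_eq (Lp.coeFn_add f g).symm
  zero_mem' := (MemLp.zero' (p := ∞)).ae_eq (Lp.coeFn_zero ℂ 2 circleMeasure).symm
  smul_mem' := fun c f hf => (hf.const_smul c).ae_eq (Lp.coeFn_smul c f).symm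

/-- `H^∞ = H² ∩ L^∞`. -/
def hardyInf : Submodule ℂ L2 := hardy ⊓ bdd

/-- The space `H²₋ = L² ⊖ H²`. -/
abbrev hardyMinus : Submodule ℂ L2 := hardyᗮ

/-- The orthogonal projection `P⁺` of `L²` onto `H²`. -/
def projPlus : L2 →L[ℂ] L2 := hardy.starProjection

/-- The orthogonal projection `P⁻` of `L²` onto `H²₋`. -/
def projMinus : L2 →L[ℂ] L2 := hardyMinus.starProjection

/-- Multiplication `f ↦ φ f` on `L²` by a bounded function `φ`. -/
def mulL (φ : Linf) : L2 →L[ℂ] L2 :=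
  (ContinuousLinearMap.mul ℂ ℂ).holderL circleMeasure ∞ 2 2 φ

theorem coeFn_mulL (φ : Linf) (f : L2) :
    mulL φ f =ᵐ[circleMeasure] fun t => φ t * f t :=
  ContinuousLinearMap.coeFn_holder (ContinuousLinearMap.mul ℂ ℂ) φ f

theorem memLp_mul_bdd (φ : L2) (f : bdd) :
    MemLp (fun t => φ t * (f : L2) t) 2 circleMeasure :=
  MemLp.mul' (p := 2) (q := ∞) f.2 (Lp.memLp φ)

/-- Multiplication `M_φ f = φ f` by a symbol `φ ∈ L²`, on the bounded functions `f`. -/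
def mulBdd (φ : L2) : bdd →ₗ[ℂ] L2 where
  toFun f := (memLp_mul_bdd φ f).toLp
  map_add' f g := by
    rw [← MemLp.toLp_add]
    refine MemLp.toLp_congr _ _ ?_
    filter_upwards [Lp.coeFn_add (f : L2) (g : L2)] with t ht
    simp only [Submodule.coe_add, ht, Pi.add_apply, mul_add]
  map_smul' c f := by
    rw [RingHom.id_apply, ← MemLp.toLp_const_smul]
    refine MemLp.toLp_congr _ _ ?_
    filter_upwards [Lp.coeFn_smul c (f : L2)] with t ht
    simp [ht, mul_left_comm]

/-- The densely defined compression `P_Y M_φ |_{X ∩ L^∞}` for `φ ∈ L²` and subspaces `X`, `Y`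
of `L²`. -/
def compress (X Y : Submodule ℂ L2) [Y.HasOrthogonalProjection] (φ : L2) :
    ↥(X ⊓ bdd) →ₗ[ℂ] Y :=
  Y.orthogonalProjectionOnto.toLinearMap ∘ₗ mulBdd φ ∘ₗ Submodule.inclusion inf_le_right

/-- An inner function, given by its boundary values: a function in `H^∞` which has modulus one
almost everywhere on the circle. -/
structure InnerFunction where
  toLinf : Linf
  analytic : ∀ n : ℤ, n < 0 → fourierCoeff toLinf n = 0
  unimodular : ∀ᵐ t ∂circleMeasure, ‖toLinf t‖ = 1

namespace InnerFunction

/-- The value at the point `w` of the unit disk. -/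
def eval (θ : InnerFunction) (w : ℂ) : ℂ := ∑' n : ℕ, fourierCoeff θ.toLinf n * w ^ n

def Nonconstant (θ : InnerFunction) : Prop :=
  ¬ ∃ c : ℂ, θ.toLinf =ᵐ[circleMeasure] fun _ => c

/-- Multiplication by `θ` on `L²`. -/
def mul (θ : InnerFunction) : L2 →L[ℂ] L2 := mulL θ.toLinf

/-- Multiplication by the complex conjugate of `θ` on `L²`. -/
def mulConj (θ : InnerFunction) : L2 →L[ℂ] L2 := mulL (star θ.toLinf)

/-- The subspace `θH²` of `L²`. -/
def range (θ : InnerFunction) : Submodule ℂ L2 := hardy.map θ.mul.toLinearMap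

theorem norm_mul_apply (θ : InnerFunction) (f : L2) : ‖θ.mul f‖ = ‖f‖ := by
  rw [Lp.norm_def, Lp.norm_def]
  congr 1
  refine eLpNorm_congr_norm_ae ?_
  filter_upwards [coeFn_mulL θ.toLinf f, θ.unimodular] with t h1 h2
  rw [mul, h1, norm_mul, h2, one_mul]

instance (θ : InnerFunction) : CompleteSpace θ.range := by
  let e : L2 →ₗᵢ[ℂ] L2 := ⟨θ.mul.toLinearMap, θ.norm_mul_apply⟩
  have h : IsComplete (e '' (hardy : Set L2)) :=
    e.isometry.isUniformInducing.isComplete_iff.2 isClosed_hardy.isComplete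
  exact completeSpace_coe_iff_isComplete.2 h

/-- The model space `K_θ = H² ⊖ θH²`. -/
def model (θ : InnerFunction) : Submodule ℂ L2 := hardy ⊓ θ.rangeᗮ

/-- The orthogonal complement `K_θ^⊥ = L² ⊖ K_θ`. -/
abbrev modelPerp (θ : InnerFunction) : Submodule ℂ L2 := θ.modelᗮ

theorem range_le_modelPerp (θ : InnerFunction) : θ.range ≤ θ.modelPerp :=
  θ.range.le_orthogonal_orthogonal.trans (Submodule.orthogonal_le inf_le_right)

theorem hardyMinus_le_modelPerp (θ : InnerFunction) : hardyMinus ≤ θ.modelPerp :=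
  Submodule.orthogonal_le inf_le_left

/-- The bounded operator `D_z^θ = P_θ^⊥ M_z` on `K_θ^⊥`. -/
def dualShift (θ : InnerFunction) : θ.modelPerp →L[ℂ] θ.modelPerp :=
  θ.modelPerp.orthogonalProjectionOnto ∘L mulL (fourierLp ∞ 1) ∘L θ.modelPerp.subtypeL

end InnerFunction

/-- `P_{αH²} M_φ |_{θH²}`, on the bounded functions in `θH²`. -/
def toeplitzHat (θ α : InnerFunction) (φ : L2) : ↥(θ.range ⊓ bdd) →ₗ[ℂ] α.range :=
  compress θ.range α.range φ

/-- `P_{αH²} M_φ |_{H²₋}`, on the bounded functions in `H²₋`. -/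
def hankelCheck (α : InnerFunction) (φ : L2) : ↥(hardyMinus ⊓ bdd) →ₗ[ℂ] α.range :=
  compress hardyMinus α.range φ

/-- `P⁻ M_φ |_{θH²}`, on the bounded functions in `θH²`. -/
def hankelHat (θ : InnerFunction) (φ : L2) : ↥(θ.range ⊓ bdd) →ₗ[ℂ] hardyMinus :=
  compress θ.range hardyMinus φ

/-- `P⁻ M_φ |_{H²₋}`, on the bounded functions in `H²₋`. -/
def toeplitzCheck (φ : L2) : ↥(hardyMinus ⊓ bdd) →ₗ[ℂ] hardyMinus :=
  compress hardyMinus hardyMinus φ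

/-- The bounded operator `D : K_θ^⊥ → K_α^⊥` has, with respect to the decompositions
`K_θ^⊥ = θH² ⊕ H²₋` and `K_α^⊥ = αH² ⊕ H²₋`, the matrix with first row
`toeplitzHat θ α ψ₁`, `hankelCheck α ψ₂` and second row `hankelHat θ ψ₃`, `toeplitzCheck ψ₄`.
The entries are densely defined, and the equality is on their domains. -/
structure HasBlockMatrix {θ α : InnerFunction} (D : θ.modelPerp →L[ℂ] α.modelPerp)
    (ψ₁ ψ₂ ψ₃ ψ₄ : L2) : Prop where
  firstColumn : ∀ f : ↥(θ.range ⊓ bdd),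
    (D ⟨f, θ.range_le_modelPerp f.2.1⟩ : L2) = toeplitzHat θ α ψ₁ f + hankelHat θ ψ₃ f
  secondColumn : ∀ f : ↥(hardyMinus ⊓ bdd),
    (D ⟨f, θ.hardyMinus_le_modelPerp f.2.1⟩ : L2) = hankelCheck α ψ₂ f + toeplitzCheck ψ₄ f

end DualTruncated

end

/-!
Write `z` for the coordinate on the circle. With respect to `K_θ^⊥ = θH² ⊕ H²₋`, the operator
`D_z^θ` multiplies by `z` on `θH²`, and on `H²₋` it is the backward shift `P⁻ M_z`, except that it
sends `z⁻¹`, which the backward shift kills, to `conj θ(0) θ`. So `D_z^θ` is a bilateral weighted shift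
with a single weight `conj θ(0)` different from `1`, and
`X_θ f = P⁻ f + conj θ(0) θ P⁺ f` (`InnerFunction.transfer`) satisfies
`D_z^θ X_θ = X_θ M_z` (`InnerFunction.shiftPerp_transfer`).

* If `θ(0) ≠ 0`, then `X_θ` is onto `K_θ^⊥`, and `D` is an intertwiner exactly when
  `D X_θ = X_α M_ψ` for some bounded `ψ`. The part `P⁻ D X_θ` has a symbol by a theorem of
  Brown–Halmos type (`exists_projMinus_mulL`). What is left of `D X_θ - X_α M_ψ` has
  values in `αH²` and commutes with multiplication by `z`, so it vanishes
  (`eq_zero_of_commutes_of_mem_hardy`).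
* If `θ(0) = 0 ≠ α(0)`, then `X_α` is invertible, and `X_α⁻¹ D` turns `D_z^θ` into
  multiplication by `z`. It vanishes on `H²₋`, where `D_z^θ` is nilpotent on each monomial
  (`map_hardyMinus_eq_zero`), and is a multiplication operator on `θH²`
  (`exists_mulL_of_commutes`).
* If `θ(0) = α(0) = 0`, both operators are direct sums of a shift and a backward shift, and the four
  entries of `D` are treated separately: an analytic multiplication operator, zero, a Hankel
  operator and a Toeplitz operator on `H²₋` with analytic symbol. The bounded symbol of the
  Hankel entry is given by Nehari's theorem (`exists_hankel_symbol`).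

Nehari's theorem is proved by duality. For an analytic polynomial `p`, a zero in the disk is moved
into a Blaschke factor and a square root of the remaining factor is taken, so that `p = u v` on the
circle with `u`, `v` in the disk algebra and `|u|² = |v|² = |p|` (`hasBalancedFactorization`). Hence
the functional `p ↦ (Γ p)^(-1)` is bounded by `‖Γ‖ ‖p‖₁`. The Hahn–Banach theorem extends it to
`L¹`, and the extension restricted to `L²` is represented by a function of `L²`, which is bounded
by `mem_bdd_of_forall_integral_le`.
-/

noncomputable section

namespace DualTruncated

/-! ### Monomials, Fourier coefficients and the Riesz projections -/

/-- The monomial `z ^ n` in `L²`. -/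
abbrev mono (n : ℤ) : L2 := fourierLp 2 n

/-- Multiplication by `z ^ n` on `L²`. -/
abbrev zpow (n : ℤ) : L2 →L[ℂ] L2 := mulL (fourierLp ∞ n)

theorem mulL_comm (φ ψ : Linf) (f : L2) : mulL φ (mulL ψ f) = mulL ψ (mulL φ f) := by
  apply Lp.ext
  filter_upwards [coeFn_mulL φ (mulL ψ f), coeFn_mulL ψ (mulL φ f), coeFn_mulL φ f,
    coeFn_mulL ψ f] with t h1 h2 h3 h4
  rw [h1, h2, h3, h4]; ring

theorem inner_mulL (φ : Linf) (f g : L2) :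
    inner ℂ (mulL φ f) g = inner ℂ f (mulL (star φ) g) := by
  rw [L2.inner_def, L2.inner_def]
  refine integral_congr_ae ?_
  filter_upwards [coeFn_mulL φ f, coeFn_mulL (star φ) g, Lp.coeFn_star φ] with t h1 h2 h3
  rw [h1, h2, h3]
  simp only [RCLike.inner_apply, map_mul, Pi.star_apply, RCLike.star_def]; ring

theorem zpow_mono (m n : ℤ) : zpow m (mono n) = mono (m + n) := by
  apply Lp.ext
  filter_upwards [coeFn_mulL (fourierLp ∞ m) (mono n), coeFn_fourierLp (T := 1) ∞ m,
    coeFn_fourierLp (T := 1) 2 n, coeFn_fourierLp (T := 1) 2 (m + n)] with t h1 h2 h3 h4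
  rw [h1, h2, h3, h4, fourier_add]

theorem zpow_zpow (m n : ℤ) (f : L2) : zpow m (zpow n f) = zpow (m + n) f := by
  apply Lp.ext
  filter_upwards [coeFn_mulL (fourierLp ∞ m) (zpow n f), coeFn_mulL (fourierLp ∞ n) f,
    coeFn_mulL (fourierLp ∞ (m + n)) f, coeFn_fourierLp (T := 1) ∞ m,
    coeFn_fourierLp (T := 1) ∞ n, coeFn_fourierLp (T := 1) ∞ (m + n)] with t h1 h2 h3 h4 h5 h6
  rw [h1, h2, h3, h4, h5, h6, fourier_add]; ring

theorem zpow_zero (f : L2) : zpow 0 f = f := by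
  apply Lp.ext
  filter_upwards [coeFn_mulL (fourierLp ∞ 0) f, coeFn_fourierLp (T := 1) ∞ 0] with t h1 h2
  rw [h1, h2, fourier_zero, one_mul]

theorem zpow_neg_zpow (n : ℤ) (f : L2) : zpow (-n) (zpow n f) = f := by
  rw [zpow_zpow, neg_add_cancel, zpow_zero]

theorem star_fourierLp (n : ℤ) : star (fourierLp ∞ n : Linf) = fourierLp ∞ (-n) := by
  apply Lp.ext
  filter_upwards [Lp.coeFn_star (fourierLp ∞ n : Linf), coeFn_fourierLp (T := 1) ∞ n,
    coeFn_fourierLp (T := 1) ∞ (-n)] with t h1 h2 h3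
  rw [h1, h3, fourier_neg, Pi.star_apply, h2]; rfl

/-- The Fourier coefficient of index `n`, as a continuous functional on `L²`. -/
def coeff (n : ℤ) : L2 →L[ℂ] ℂ := innerSL ℂ (mono n)

theorem coeff_apply (n : ℤ) (f : L2) : coeff n f = inner ℂ (mono n) f := rfl

theorem fourierCoeff_eq_coeff (f : L2) (n : ℤ) : fourierCoeff f n = coeff n f := by
  rw [fourierCoeff_L2, HilbertBasis.repr_apply_apply, coe_fourierBasis, coeff_apply]

theorem coeff_zpow (m n : ℤ) (f : L2) : coeff n (zpow m f) = coeff (n - m) f := by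
  rw [coeff_apply, coeff_apply, ← inner_conj_symm, inner_mulL, star_fourierLp, inner_conj_symm]
  change inner ℂ (zpow (-m) (mono n)) f = _
  rw [zpow_mono]; congr 2; ring

theorem coeff_mono (m n : ℤ) : coeff m (mono n) = if m = n then 1 else 0 :=
  orthonormal_iff_ite.1 orthonormal_fourier m n

theorem coeff_mono_ne {m n : ℤ} (h : m ≠ n) : coeff m (mono n) = 0 := by simp [coeff_mono, h]

theorem hasSum_coeff (f : L2) : HasSum (fun n => coeff n f • mono n) f := by
  simpa only [fourierCoeff_eq_coeff] using hasSum_fourier_series_L2 f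

theorem ext_coeff {f g : L2} (h : ∀ n, coeff n f = coeff n g) : f = g :=
  (hasSum_coeff f).unique (by simpa only [h] using hasSum_coeff g)

/-- Two continuous linear maps agree at `f` if they agree at each monomial of its Fourier series. -/
theorem map_eq_of_mono {F : Type*} [NormedAddCommGroup F] [NormedSpace ℂ F] {S T : L2 →L[ℂ] F}
    {f : L2} (h : ∀ n, coeff n f = 0 ∨ S (mono n) = T (mono n)) : S f = T f := by
  have h1 := S.hasSum (hasSum_coeff f)
  have h2 := T.hasSum (hasSum_coeff f)
  refine h1.unique (h2.congr_fun fun n => ?_)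
  rcases h n with h | h <;> simp [h]

theorem mem_hardy {f : L2} : f ∈ hardy ↔ ∀ n < 0, coeff n f = 0 := by
  simp only [← fourierCoeff_eq_coeff]; rfl

theorem mono_mem_hardy {n : ℤ} (hn : 0 ≤ n) : mono n ∈ hardy :=
  mem_hardy.2 fun m hm => coeff_mono_ne (by omega)

theorem mem_hardyMinus {f : L2} : f ∈ hardyMinus ↔ ∀ n, 0 ≤ n → coeff n f = 0 := by
  rw [Submodule.mem_orthogonal]
  refine ⟨fun h n hn => h _ (mono_mem_hardy hn), fun h g hg => ?_⟩
  have : innerSL ℂ f g = (0 : L2 →L[ℂ] ℂ) g := by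
    refine map_eq_of_mono fun n => ?_
    rcases lt_or_ge n 0 with hn | hn
    · exact Or.inl (mem_hardy.1 hg n hn)
    · refine Or.inr ?_
      rw [innerSL_apply_apply, ← inner_conj_symm, ← coeff_apply, h n hn]; simp
  rw [← inner_conj_symm, ← innerSL_apply_apply ℂ, this]; simp

theorem mono_mem_hardyMinus {n : ℤ} (hn : n < 0) : mono n ∈ hardyMinus :=
  mem_hardyMinus.2 fun m hm => coeff_mono_ne (by omega)

/-- `map_eq_of_mono` for functions of `H²`. -/
theorem map_eq_on_hardy {F : Type*} [NormedAddCommGroup F] [NormedSpace ℂ F] {S T : L2 →L[ℂ] F}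
    (h : ∀ n, 0 ≤ n → S (mono n) = T (mono n)) {f : L2} (hf : f ∈ hardy) : S f = T f :=
  map_eq_of_mono fun n => (lt_or_ge n 0).imp (mem_hardy.1 hf n) (h n)

/-- `map_eq_of_mono` for functions of `H²₋`. -/
theorem map_eq_on_hardyMinus {F : Type*} [NormedAddCommGroup F] [NormedSpace ℂ F]
    {S T : L2 →L[ℂ] F} (h : ∀ n < 0, S (mono n) = T (mono n)) {f : L2} (hf : f ∈ hardyMinus) :
    S f = T f :=
  map_eq_of_mono fun n => (le_or_gt 0 n).imp (mem_hardyMinus.1 hf n) (h n)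

theorem map_ext_mono {F : Type*} [NormedAddCommGroup F] [NormedSpace ℂ F] {S T : L2 →L[ℂ] F}
    (h : ∀ n, S (mono n) = T (mono n)) : S = T :=
  ContinuousLinearMap.ext fun _ => map_eq_of_mono fun n => Or.inr (h n)

theorem projPlus_mem (f : L2) : projPlus f ∈ hardy := hardy.starProjection_apply_mem f

theorem projMinus_mem (f : L2) : projMinus f ∈ hardyMinus := hardyMinus.starProjection_apply_mem f

theorem projPlus_add_projMinus (f : L2) : projPlus f + projMinus f = f :=
  hardy.starProjection_add_starProjection_orthogonal f

theorem projPlus_of_mem {f : L2} (hf : f ∈ hardy) : projPlus f = f :=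
  Submodule.starProjection_eq_self_iff.2 hf

theorem projMinus_of_mem {f : L2} (hf : f ∈ hardyMinus) : projMinus f = f :=
  Submodule.starProjection_eq_self_iff.2 hf

theorem projMinus_of_mem_hardy {f : L2} (hf : f ∈ hardy) : projMinus f = 0 := by
  have := projPlus_add_projMinus f
  rwa [projPlus_of_mem hf, add_eq_left] at this

theorem projPlus_of_mem_hardyMinus {f : L2} (hf : f ∈ hardyMinus) : projPlus f = 0 := by
  have := projPlus_add_projMinus f
  rwa [projMinus_of_mem hf, add_eq_right] at this

theorem projMinus_eq_zero_iff {f : L2} : projMinus f = 0 ↔ f ∈ hardy := by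
  refine ⟨fun h => ?_, projMinus_of_mem_hardy⟩
  rw [← projPlus_add_projMinus f, h, add_zero]; exact projPlus_mem f

theorem coeff_projPlus {n : ℤ} (hn : 0 ≤ n) (f : L2) : coeff n (projPlus f) = coeff n f := by
  conv_rhs => rw [← projPlus_add_projMinus f]
  rw [map_add, mem_hardyMinus.1 (projMinus_mem f) n hn, add_zero]

theorem coeff_projPlus_neg {n : ℤ} (hn : n < 0) (f : L2) : coeff n (projPlus f) = 0 :=
  mem_hardy.1 (projPlus_mem f) n hn

theorem coeff_projMinus {n : ℤ} (hn : n < 0) (f : L2) : coeff n (projMinus f) = coeff n f := by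
  conv_rhs => rw [← projPlus_add_projMinus f]
  rw [map_add, mem_hardy.1 (projPlus_mem f) n hn, zero_add]

theorem coeff_projMinus_nonneg {n : ℤ} (hn : 0 ≤ n) (f : L2) : coeff n (projMinus f) = 0 :=
  mem_hardyMinus.1 (projMinus_mem f) n hn

theorem zpow_mem_hardy {n : ℤ} (hn : 0 ≤ n) {f : L2} (hf : f ∈ hardy) : zpow n f ∈ hardy :=
  mem_hardy.2 fun m hm => by rw [coeff_zpow]; exact mem_hardy.1 hf _ (by omega)

theorem zpow_mem_hardyMinus {n : ℤ} (hn : n ≤ 0) {f : L2} (hf : f ∈ hardyMinus) :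
    zpow n f ∈ hardyMinus :=
  mem_hardyMinus.2 fun m hm => by rw [coeff_zpow]; exact mem_hardyMinus.1 hf _ (by omega)

theorem projMinus_zpow_projMinus {n : ℤ} (hn : 0 ≤ n) (f : L2) :
    projMinus (zpow n (projMinus f)) = projMinus (zpow n f) := by
  conv_rhs => rw [← projPlus_add_projMinus f]
  rw [map_add, map_add, projMinus_of_mem_hardy (zpow_mem_hardy hn (projPlus_mem f)), zero_add]

/-- The shift of the analytic part: `P⁺(z f) = z P⁺ f + f̂(-1)`. -/
theorem projPlus_zpow_one (f : L2) :
    projPlus (zpow 1 f) = zpow 1 (projPlus f) + coeff (-1) f • mono 0 := by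
  refine ext_coeff fun n => ?_
  rw [map_add, map_smul, coeff_zpow, coeff_mono, smul_eq_mul]
  rcases lt_trichotomy n 0 with hn | rfl | hn
  · rw [coeff_projPlus_neg hn, coeff_projPlus_neg (by omega), if_neg hn.ne]; simp
  · rw [coeff_projPlus le_rfl, coeff_projPlus_neg (by omega), coeff_zpow]; simp
  · rw [coeff_projPlus hn.le, coeff_projPlus (by omega), coeff_zpow, if_neg hn.ne']; simp

theorem inner_projMinus (f g : L2) : inner ℂ (projMinus f) g = inner ℂ f (projMinus g) :=
  hardyMinus.inner_starProjection_left_eq_right f g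

/-! ### Bounded functions -/

/-- A bounded function of `L²`, as an element of `L^∞`. -/
def toLinf {f : L2} (hf : f ∈ bdd) : Linf := MemLp.toLp f hf

theorem coeFn_toLinf {f : L2} (hf : f ∈ bdd) : toLinf hf =ᵐ[circleMeasure] f :=
  MemLp.coeFn_toLp (show MemLp f ∞ circleMeasure from hf)

theorem coeFn_mono_zero : (mono 0 : L2) =ᵐ[circleMeasure] fun _ => (1 : ℂ) := by
  filter_upwards [coeFn_fourierLp (T := 1) 2 0] with t h
  rw [h, fourier_zero]

theorem coeFn_mulL_mono_zero (φ : Linf) : mulL φ (mono 0) =ᵐ[circleMeasure] φ := by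
  filter_upwards [coeFn_mulL φ (mono 0), coeFn_mono_zero] with t h1 h2
  rw [h1, h2, mul_one]

theorem mulL_mem_bdd (φ : Linf) {f : L2} (hf : f ∈ bdd) : mulL φ f ∈ bdd :=
  (MemLp.mul' (p := ∞) (q := ∞) (r := ∞) hf (Lp.memLp φ)).ae_eq (coeFn_mulL φ f).symm

theorem mono_mem_bdd (n : ℤ) : mono n ∈ bdd := by
  refine (Lp.memLp (fourierLp ∞ n : Linf)).ae_eq ?_
  filter_upwards [coeFn_fourierLp (T := 1) ∞ n, coeFn_fourierLp (T := 1) 2 n] with t h1 h2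
  rw [h1, h2]

theorem mulL_mono_zero_mem_bdd (φ : Linf) : mulL φ (mono 0) ∈ bdd :=
  mulL_mem_bdd φ (mono_mem_bdd 0)

theorem mulL_toLinf_mono_zero {f : L2} (hf : f ∈ bdd) : mulL (toLinf hf) (mono 0) = f :=
  Lp.ext ((coeFn_mulL_mono_zero _).trans (coeFn_toLinf hf))

theorem mulL_toLinf_comm {f g : L2} (hf : f ∈ bdd) (hg : g ∈ bdd) :
    mulL (toLinf hf) g = mulL (toLinf hg) f := by
  apply Lp.ext
  filter_upwards [coeFn_mulL (toLinf hf) g, coeFn_mulL (toLinf hg) f, coeFn_toLinf hf,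
    coeFn_toLinf hg] with t h1 h2 h3 h4
  rw [h1, h2, h3, h4, mul_comm]

theorem mulBdd_apply (φ : L2) {f : L2} (hf : f ∈ bdd) :
    mulBdd φ ⟨f, hf⟩ = mulL (toLinf hf) φ := by
  apply Lp.ext
  filter_upwards [(memLp_mul_bdd φ ⟨f, hf⟩).coeFn_toLp, coeFn_mulL (toLinf hf) φ,
    coeFn_toLinf hf] with t h1 h2 h3
  rw [h2, h3, mul_comm]; exact h1

theorem mulL_mono_eq (φ : Linf) (n : ℤ) : mulL φ (mono n) = zpow n (mulL φ (mono 0)) := by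
  rw [mulL_comm, zpow_mono, add_zero]

theorem mulL_mem_hardy {φ : Linf} (hφ : mulL φ (mono 0) ∈ hardy) {f : L2} (hf : f ∈ hardy) :
    mulL φ f ∈ hardy := by
  rw [← projMinus_eq_zero_iff]
  refine map_eq_on_hardy (S := projMinus ∘L mulL φ) (T := 0) (fun n hn => ?_) hf
  rw [ContinuousLinearMap.comp_apply, mulL_mono_eq]
  exact projMinus_of_mem_hardy (zpow_mem_hardy hn hφ)

/-- If `φ` is analytic, then multiplication by its conjugate preserves `H²₋`. -/
theorem mulL_star_mem_hardyMinus {φ : Linf} (hφ : mulL φ (mono 0) ∈ hardy) {f : L2}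
    (hf : f ∈ hardyMinus) : mulL (star φ) f ∈ hardyMinus := by
  rw [Submodule.mem_orthogonal]
  intro g hg
  rw [← inner_mulL]
  exact Submodule.inner_right_of_mem_orthogonal (mulL_mem_hardy hφ hg) hf

/-- A product of two functions of `H²`, one of which is bounded, lies in `H²`. -/
theorem mulL_toLinf_mem_hardy {h : L2} (hb : h ∈ bdd) (hh : h ∈ hardy) {f : L2} (hf : f ∈ hardy) :
    mulL (toLinf hb) f ∈ hardy :=
  mulL_mem_hardy (by rwa [mulL_toLinf_mono_zero]) hf

/-- A product of two functions of `H²₋`, one of which is bounded, lies in `H²₋`. -/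
theorem mulL_toLinf_mem_hardyMinus {h : L2} (hb : h ∈ bdd) (hh : h ∈ hardyMinus) {f : L2}
    (hf : f ∈ hardyMinus) : mulL (toLinf hb) f ∈ hardyMinus := by
  have : (projPlus ∘L mulL (toLinf hb)) f = (0 : L2 →L[ℂ] L2) f := by
    refine map_eq_on_hardyMinus (fun n hn => ?_) hf
    rw [ContinuousLinearMap.comp_apply, mulL_mono_eq, mulL_toLinf_mono_zero]
    exact projPlus_of_mem_hardyMinus (zpow_mem_hardyMinus hn.le hh)
  have h2 := projPlus_add_projMinus (mulL (toLinf hb) f)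
  rw [show projPlus (mulL (toLinf hb) f) = 0 from this, zero_add] at h2
  rw [← h2]; exact projMinus_mem _

/-! ### Inner functions and the projection onto `K_θ^⊥` -/

namespace InnerFunction

variable (θ : InnerFunction)

theorem mulConj_mul (f : L2) : θ.mulConj (θ.mul f) = f := by
  apply Lp.ext
  filter_upwards [coeFn_mulL (star θ.toLinf) (θ.mul f), coeFn_mulL θ.toLinf f,
    Lp.coeFn_star θ.toLinf, θ.unimodular] with t h1 h2 h3 h4
  rw [mulConj, h1, h3, mul, h2, Pi.star_apply, ← mul_assoc, RCLike.star_def,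
    ← Complex.normSq_eq_conj_mul_self, Complex.normSq_eq_norm_sq, h4]
  simp

theorem mul_mulConj (f : L2) : θ.mul (θ.mulConj f) = f := by
  rw [mul, mulConj, mulL_comm]; exact θ.mulConj_mul f

theorem inner_mul (f g : L2) : inner ℂ (θ.mul f) g = inner ℂ f (θ.mulConj g) := inner_mulL _ f g

theorem mul_mono_zero_mem_hardy : mulL θ.toLinf (mono 0) ∈ hardy := by
  intro n hn
  rw [fourierCoeff_congr_ae (coeFn_mulL_mono_zero _)]
  exact θ.analytic n hn

theorem mul_mem_hardy {f : L2} (hf : f ∈ hardy) : θ.mul f ∈ hardy :=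
  mulL_mem_hardy θ.mul_mono_zero_mem_hardy hf

theorem mulConj_mem_hardyMinus {f : L2} (hf : f ∈ hardyMinus) : θ.mulConj f ∈ hardyMinus :=
  mulL_star_mem_hardyMinus θ.mul_mono_zero_mem_hardy hf

theorem eval_zero : θ.eval 0 = coeff 0 (θ.mul (mono 0)) := by
  rw [eval, tsum_eq_single 0 (fun n hn => by simp [hn]), ← fourierCoeff_eq_coeff, mul,
    fourierCoeff_congr_ae (coeFn_mulL_mono_zero _)]
  simp

theorem mul_zpow (n : ℤ) (f : L2) : θ.mul (zpow n f) = zpow n (θ.mul f) := mulL_comm _ _ f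

theorem projPlus_mulConj_mono_zero :
    projPlus (θ.mulConj (mono 0)) = conj (θ.eval 0) • mono 0 := by
  refine ext_coeff fun n => ?_
  rw [map_smul, coeff_mono, smul_eq_mul]
  rcases lt_or_ge n 0 with hn | hn
  · rw [coeff_projPlus_neg hn, if_neg hn.ne, mul_zero]
  · rw [coeff_projPlus hn, coeff_apply, ← inner_mul, ← inner_conj_symm, ← coeff_apply]
    split_ifs with h
    · subst h; rw [← eval_zero, mul_one]
    · rw [mul, mulL_mono_eq, coeff_zpow, mem_hardy.1 θ.mul_mono_zero_mem_hardy _ (by omega)]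
      simp

theorem mul_mem_range {f : L2} (hf : f ∈ hardy) : θ.mul f ∈ θ.range := ⟨f, hf, rfl⟩

/-- The projection onto `θH²` is `θ P⁺ θ̄`. -/
theorem starProjection_range (f : L2) :
    θ.range.starProjection f = θ.mul (projPlus (θ.mulConj f)) := by
  refine Submodule.eq_starProjection_of_mem_orthogonal (θ.mul_mem_range (projPlus_mem _)) ?_
  rw [Submodule.mem_orthogonal]
  rintro _ ⟨h, hh, rfl⟩
  change inner ℂ (θ.mul h) _ = _
  rw [inner_mul, map_sub, mulConj_mul]
  have : θ.mulConj f - projPlus (θ.mulConj f) = projMinus (θ.mulConj f) := by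
    rw [sub_eq_iff_eq_add']; exact (projPlus_add_projMinus _).symm
  rw [this]
  exact Submodule.inner_right_of_mem_orthogonal hh (projMinus_mem _)

/-- The coordinate `f ↦ P⁺(θ̄ f)` of `f` along `θH²`. -/
def coord : L2 →L[ℂ] L2 := projPlus ∘L θ.mulConj

theorem coord_apply (f : L2) : θ.coord f = projPlus (θ.mulConj f) := rfl

/-- The operator `f ↦ θ P⁺(θ̄ f) + P⁻ f`, which is the projection onto `K_θ^⊥`. -/
def projPerp : L2 →L[ℂ] L2 := θ.mul ∘L θ.coord + projMinus

theorem projPerp_apply (f : L2) : θ.projPerp f = θ.mul (θ.coord f) + projMinus f := rfl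

theorem coord_mem (f : L2) : θ.coord f ∈ hardy := projPlus_mem _

theorem coord_of_mem_hardyMinus {f : L2} (hf : f ∈ hardyMinus) : θ.coord f = 0 :=
  projPlus_of_mem_hardyMinus (θ.mulConj_mem_hardyMinus hf)

theorem coord_mul {f : L2} (hf : f ∈ hardy) : θ.coord (θ.mul f) = f := by
  rw [coord_apply, mulConj_mul, projPlus_of_mem hf]

theorem starProjection_modelPerp (f : L2) : θ.modelPerp.starProjection f = θ.projPerp f := by
  refine Submodule.eq_starProjection_of_mem_orthogonal
    (add_mem (θ.range_le_modelPerp (θ.mul_mem_range (projPlus_mem _)))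
      (θ.hardyMinus_le_modelPerp (projMinus_mem _))) ?_
  refine θ.model.le_orthogonal_orthogonal ?_
  have h1 : f - (θ.mul (θ.coord f) + projMinus f) = projPlus f - θ.mul (θ.coord f) := by
    nth_rewrite 1 [← projPlus_add_projMinus f]; abel
  change f - (θ.mul (θ.coord f) + projMinus f) ∈ _
  refine ⟨?_, ?_⟩
  · rw [h1]
    exact sub_mem (projPlus_mem _) (θ.mul_mem_hardy (projPlus_mem _))
  · rw [← sub_sub]
    refine sub_mem ?_ ?_
    · rw [coord_apply, ← starProjection_range]
      exact Submodule.sub_starProjection_mem_orthogonal f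
    · refine Submodule.orthogonal_le ?_ (projMinus_mem f)
      rintro _ ⟨h, hh, rfl⟩
      exact θ.mul_mem_hardy hh

theorem projPerp_mem (f : L2) : θ.projPerp f ∈ θ.modelPerp := by
  rw [← starProjection_modelPerp]; exact Submodule.starProjection_apply_mem _ f

theorem projPerp_of_mem {f : L2} (hf : f ∈ θ.modelPerp) : θ.projPerp f = f := by
  rw [← starProjection_modelPerp]; exact Submodule.starProjection_eq_self_iff.2 hf

theorem projMinus_projPerp (f : L2) : projMinus (θ.projPerp f) = projMinus f := by
  rw [projPerp_apply, map_add, projMinus_of_mem (projMinus_mem f),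
    projMinus_of_mem_hardy (θ.mul_mem_hardy (θ.coord_mem f)), zero_add]

theorem coord_projPerp (f : L2) : θ.coord (θ.projPerp f) = θ.coord f := by
  rw [projPerp_apply, map_add, coord_mul _ (θ.coord_mem f),
    coord_of_mem_hardyMinus _ (projMinus_mem f), add_zero]

/-- The operator `f ↦ P_{K_θ^⊥}(z f)` on `L²`, which extends `D_z^θ`. -/
def shiftPerp : L2 →L[ℂ] L2 := θ.projPerp ∘L zpow 1

theorem shiftPerp_apply (f : L2) : θ.shiftPerp f = θ.projPerp (zpow 1 f) := rfl

theorem coe_dualShift (x : θ.modelPerp) : (θ.dualShift x : L2) = θ.shiftPerp x := by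
  rw [shiftPerp_apply, ← starProjection_modelPerp]; rfl

theorem projMinus_shiftPerp (f : L2) :
    projMinus (θ.shiftPerp f) = projMinus (zpow 1 (projMinus f)) := by
  rw [shiftPerp_apply, projMinus_projPerp, projMinus_zpow_projMinus zero_le_one]

/-- The coordinate along `θH²` of `D_z^θ f`: the shifted coordinate, plus the term that crosses
over from `H²₋`. -/
theorem coord_shiftPerp {f : L2} (hf : f ∈ θ.modelPerp) :
    θ.coord (θ.shiftPerp f) =
      zpow 1 (θ.coord f) + (conj (θ.eval 0) * coeff (-1) f) • mono 0 := by
  have h1 : coeff (-1) f = coeff (-1) (projMinus f) := (coeff_projMinus (by norm_num) f).symm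
  have h2 : zpow 1 (projMinus f) = projMinus (zpow 1 (projMinus f)) + coeff (-1) f • mono 0 := by
    conv_lhs => rw [← projPlus_add_projMinus (zpow 1 (projMinus f)), projPlus_zpow_one,
      projPlus_of_mem_hardyMinus (projMinus_mem f), map_zero, zero_add, ← h1, add_comm]
  rw [shiftPerp_apply, coord_projPerp]
  conv_lhs => rw [← θ.projPerp_of_mem hf, projPerp_apply, map_add, map_add, ← mul_zpow,
    coord_mul _ (zpow_mem_hardy zero_le_one (θ.coord_mem f)), h2, map_add,
    coord_of_mem_hardyMinus _ (projMinus_mem _), zero_add, map_smul, coord_apply θ (mono 0),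
    projPlus_mulConj_mono_zero, smul_smul, mul_comm (coeff _ _)]

/-- The operator `f ↦ P⁻ f + conj θ(0) θ P⁺ f` from `L²` to `K_θ^⊥`. It intertwines the bilateral
shift with `D_z^θ`, and is invertible when `θ(0) ≠ 0`. -/
def transfer : L2 →L[ℂ] L2 := projMinus + conj (θ.eval 0) • (θ.mul ∘L projPlus)

theorem transfer_apply (f : L2) :
    θ.transfer f = projMinus f + conj (θ.eval 0) • θ.mul (projPlus f) := rfl

theorem transfer_mem (f : L2) : θ.transfer f ∈ θ.modelPerp :=
  add_mem (θ.hardyMinus_le_modelPerp (projMinus_mem f))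
    (Submodule.smul_mem _ _ (θ.range_le_modelPerp (θ.mul_mem_range (projPlus_mem f))))

theorem projMinus_transfer (f : L2) : projMinus (θ.transfer f) = projMinus f := by
  rw [transfer_apply, map_add, map_smul, projMinus_of_mem (projMinus_mem f),
    projMinus_of_mem_hardy (θ.mul_mem_hardy (projPlus_mem f)), smul_zero, add_zero]

theorem coord_transfer (f : L2) : θ.coord (θ.transfer f) = conj (θ.eval 0) • projPlus f := by
  rw [transfer_apply, map_add, map_smul, coord_mul _ (projPlus_mem f),
    coord_of_mem_hardyMinus _ (projMinus_mem f), zero_add]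

theorem eq_of_coord {f g : L2} (hf : f ∈ θ.modelPerp) (hg : g ∈ θ.modelPerp)
    (h1 : θ.coord f = θ.coord g) (h2 : projMinus f = projMinus g) : f = g := by
  rw [← θ.projPerp_of_mem hf, ← θ.projPerp_of_mem hg, projPerp_apply, projPerp_apply, h1, h2]

theorem shiftPerp_transfer (f : L2) : θ.shiftPerp (θ.transfer f) = θ.transfer (zpow 1 f) := by
  refine θ.eq_of_coord (θ.projPerp_mem _) (θ.transfer_mem _) ?_ ?_
  · rw [coord_shiftPerp _ (θ.transfer_mem f), coord_transfer, coord_transfer, projPlus_zpow_one,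
      ← coeff_projMinus (by norm_num) (θ.transfer f), projMinus_transfer,
      coeff_projMinus (by norm_num), smul_add, smul_smul, map_smul]
  · rw [projMinus_shiftPerp, projMinus_transfer, projMinus_transfer,
      projMinus_zpow_projMinus zero_le_one]

theorem transfer_of_mem_hardy {f : L2} (hf : f ∈ hardy) :
    θ.transfer f = conj (θ.eval 0) • θ.mul f := by
  rw [transfer_apply, projMinus_of_mem_hardy hf, projPlus_of_mem hf, zero_add]

theorem transfer_of_mem_hardyMinus {f : L2} (hf : f ∈ hardyMinus) : θ.transfer f = f := by
  rw [transfer_apply, projMinus_of_mem hf, projPlus_of_mem_hardyMinus hf, map_zero, smul_zero,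
    add_zero]

theorem shiftPerp_mul {f : L2} (hf : f ∈ hardy) : θ.shiftPerp (θ.mul f) = θ.mul (zpow 1 f) := by
  rw [shiftPerp_apply, ← mul_zpow]
  exact θ.projPerp_of_mem (θ.range_le_modelPerp
    (θ.mul_mem_range (zpow_mem_hardy zero_le_one hf)))

theorem shiftPerp_mono {n : ℤ} (hn : n < -1) : θ.shiftPerp (mono n) = mono (n + 1) := by
  rw [shiftPerp_apply, zpow_mono, add_comm]
  exact θ.projPerp_of_mem (θ.hardyMinus_le_modelPerp (mono_mem_hardyMinus (by omega)))

theorem shiftPerp_mono_neg_one :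
    θ.shiftPerp (mono (-1)) = conj (θ.eval 0) • θ.mul (mono 0) := by
  rw [← θ.transfer_of_mem_hardyMinus (mono_mem_hardyMinus (n := -1) (by norm_num)),
    shiftPerp_transfer, zpow_mono, transfer_of_mem_hardy _ (mono_mem_hardy (by norm_num))]
  rfl

end InnerFunction

/-! ### Boundedness of symbols -/

/-- A function of `L²` is bounded as soon as its integrals against all functions dominated by
indicator functions `1_s` are `O(m(s))`. -/
theorem mem_bdd_of_forall_integral_le {φ : L2} {C : ℝ}
    (h : ∀ (s : Set UnitAddCircle) (F : Linf), MeasurableSet s →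
      (∀ᵐ t ∂circleMeasure, ‖F t‖ ≤ s.indicator 1 t) →
      ‖∫ t, F t * φ t ∂circleMeasure‖ ≤ C * circleMeasure.real s) : φ ∈ bdd := by
  have hφ : Integrable φ circleMeasure := (Lp.memLp φ).integrable (by norm_num)
  have hm : StronglyMeasurable φ := Lp.stronglyMeasurable φ
  have key : (fun t => ‖φ t‖) ≤ᵐ[circleMeasure] fun _ => C := by
    refine ae_le_of_forall_setIntegral_le hφ.norm (integrable_const C) fun s hs _ => ?_
    let u : UnitAddCircle → ℂ := s.indicator fun t => conj (φ t) / ‖φ t‖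
    have hum : AEStronglyMeasurable u circleMeasure := by
      refine (Measurable.indicator ?_ hs).aestronglyMeasurable
      have := hm.measurable
      fun_prop
    have hub : ∀ t, ‖u t‖ ≤ s.indicator 1 t := by
      intro t
      by_cases ht : t ∈ s
      · simp only [u, Set.indicator_of_mem ht, Pi.one_apply]
        rw [norm_div, RCLike.norm_conj, Complex.norm_real, norm_norm]
        exact div_self_le_one _
      · simp [u, Set.indicator_of_notMem ht]
    have hu : MemLp u ∞ circleMeasure := by
      refine memLp_top_of_bound hum 1 (Filter.Eventually.of_forall fun t => (hub t).trans ?_)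
      exact Set.indicator_le_self' (fun _ _ => zero_le_one) t
    have h1 := h s hu.toLp hs (by
      filter_upwards [hu.coeFn_toLp] with t ht
      rw [ht]; exact hub t)
    have h2 : ∫ t, (hu.toLp : Linf) t * φ t ∂circleMeasure
        = ((∫ t in s, ‖φ t‖ ∂circleMeasure : ℝ) : ℂ) := by
      rw [← integral_indicator hs, ← integral_complex_ofReal]
      refine integral_congr_ae ?_
      filter_upwards [hu.coeFn_toLp] with t ht
      rw [ht]
      by_cases hts : t ∈ s
      · simp only [u, Set.indicator_of_mem hts]
        by_cases h0 : φ t = 0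
        · simp [h0]
        · have : (‖φ t‖ : ℂ) ≠ 0 := by simpa using h0
          rw [div_mul_eq_mul_div, ← Complex.normSq_eq_conj_mul_self, Complex.normSq_eq_norm_sq]
          push_cast
          field_simp
      · simp [u, Set.indicator_of_notMem hts]
    rw [h2, Complex.norm_real] at h1
    rw [setIntegral_const, smul_eq_mul, mul_comm]
    exact (le_abs_self _).trans h1
  exact memLp_top_of_bound hm.aestronglyMeasurable C key

theorem dense_span_mono : Dense (Submodule.span ℂ (Set.range mono) : Set L2) := by
  rw [Submodule.dense_iff_topologicalClosure_eq_top]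
  exact span_fourierLp_closure_eq_top (by norm_num)

theorem norm_zpow (n : ℤ) (f : L2) : ‖zpow n f‖ = ‖f‖ := by
  have h : inner ℂ (zpow n f) (zpow n f) = inner ℂ f f := by
    rw [inner_mulL, star_fourierLp, zpow_neg_zpow]
  rw [inner_self_eq_norm_sq_to_K, inner_self_eq_norm_sq_to_K] at h
  exact (sq_eq_sq₀ (norm_nonneg _) (norm_nonneg _)).1 (by exact_mod_cast h)

theorem mulL_sum {ι : Type*} (s : Finset ι) (c : ι → ℂ) (P : ι → Linf) (f : L2) :
    mulL (∑ j ∈ s, c j • P j) f = ∑ j ∈ s, c j • mulL (P j) f := by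
  simp only [mulL, map_sum, map_smul, sum_apply, smul_apply]

theorem inner_mulL_star (P Q : Linf) (φ : L2) :
    inner ℂ (mulL Q (star φ)) (mulL P (mono 0)) = inner ℂ (mulL Q (mono 0)) (mulL P φ) := by
  rw [L2.inner_def, L2.inner_def]
  refine integral_congr_ae ?_
  filter_upwards [coeFn_mulL Q (star φ), coeFn_mulL_mono_zero P, coeFn_mulL_mono_zero Q,
    coeFn_mulL P φ, Lp.coeFn_star φ] with t h1 h2 h3 h4 h5
  rw [h1, h2, h3, h4, h5]
  simp only [RCLike.inner_apply, map_mul, Pi.star_apply, RCLike.star_def, RCLike.conj_conj]; ring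

/-- A symbol whose multiplication operator, tested on trigonometric polynomials up to a shift,
agrees with a bounded operator, is bounded. -/
theorem mem_bdd_of_shift_eq {φ : L2} {T : L2 →L[ℂ] L2}
    (hT : ∀ s : Finset ℤ, ∃ m : ℤ, ∀ j ∈ s, T (mono (m + j)) = zpow (m + j) φ) : φ ∈ bdd := by
  have hA : ∀ p ∈ Submodule.span ℂ (Set.range mono),
      ∃ P : Linf, mulL P (mono 0) = p ∧ ‖mulL P φ‖ ≤ ‖T‖ * ‖p‖ := by
    intro p hp
    obtain ⟨c, rfl⟩ := Finsupp.mem_span_range_iff_exists_finsupp.1 hp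
    obtain ⟨m, hm⟩ := hT c.support
    refine ⟨∑ j ∈ c.support, c j • fourierLp ∞ j, ?_, ?_⟩
    · rw [mulL_sum, Finsupp.sum]
      refine Finset.sum_congr rfl fun j _ => ?_
      rw [zpow_mono, add_zero]
    · have h1 : zpow m (mulL (∑ j ∈ c.support, c j • fourierLp ∞ j) φ) =
          T (zpow m (c.sum fun j a => a • mono j)) := by
        rw [mulL_sum, Finsupp.sum, map_sum, map_sum, map_sum]
        refine Finset.sum_congr rfl fun j hj => ?_
        rw [map_smul, map_smul, map_smul, zpow_zpow, zpow_mono, hm j hj]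
      rw [← norm_zpow m, h1, ← norm_zpow m (c.sum _)]
      exact T.le_opNorm _
  -- The form `(q, f) ↦ ∫ q̄ φ f` is bounded for trigonometric polynomials `f`, hence for all `f`.
  have hB : ∀ (Q : Linf) (f : L2),
      ‖inner ℂ (mulL Q (star φ)) f‖ ≤ ‖T‖ * ‖mulL Q (mono 0)‖ * ‖f‖ := by
    intro Q f
    refine dense_span_mono.induction (P := fun f => ‖inner ℂ (mulL Q (star φ)) f‖ ≤
      ‖T‖ * ‖mulL Q (mono 0)‖ * ‖f‖) (fun p hp => ?_)
      (isClosed_le (by fun_prop) (by fun_prop)) f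
    obtain ⟨P, rfl, hP⟩ := hA p hp
    rw [inner_mulL_star]
    refine (norm_inner_le_norm _ _).trans ?_
    calc _ ≤ ‖mulL Q (mono 0)‖ * (‖T‖ * ‖mulL P (mono 0)‖) := by gcongr
      _ = _ := by ring
  -- For fixed bounded `f` the function `φ f` lies in `L²`, so density applies in `q` as well.
  have hC : ∀ (F : Linf) (q : L2),
      ‖inner ℂ q (mulL F φ)‖ ≤ ‖T‖ * ‖q‖ * ‖mulL F (mono 0)‖ := by
    intro F q
    refine dense_span_mono.induction (P := fun q => ‖inner ℂ q (mulL F φ)‖ ≤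
      ‖T‖ * ‖q‖ * ‖mulL F (mono 0)‖) (fun q hq => ?_)
      (isClosed_le (by fun_prop) (by fun_prop)) q
    obtain ⟨Q, rfl, _⟩ := hA q hq
    rw [← inner_mulL_star]
    exact hB Q _
  refine mem_bdd_of_forall_integral_le (C := ‖T‖) fun s F hs hF => ?_
  -- Testing against `q = 1_s` gives `‖T‖ ‖q‖² = ‖T‖ m(s)`.
  let q : L2 := indicatorConstLp 2 hs (measure_ne_top _ _) (1 : ℂ)
  have hq : ‖q‖ * ‖q‖ = circleMeasure.real s := by
    rw [norm_indicatorConstLp (by norm_num) (by norm_num), norm_one, one_mul,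
      ← Real.rpow_add_of_nonneg measureReal_nonneg (by positivity) (by positivity)]
    norm_num
  have hFq : ‖mulL F (mono 0)‖ ≤ ‖q‖ := by
    refine Lp.norm_le_norm_of_ae_le ?_
    filter_upwards [coeFn_mulL_mono_zero F, indicatorConstLp_coeFn (p := 2) (hs := hs)
      (hμs := measure_ne_top circleMeasure s) (c := (1 : ℂ)), hF] with t h1 h2 h3
    rw [h1, h2]
    refine h3.trans ?_
    by_cases ht : t ∈ s <;> simp [ht]
  have hint : ∫ t, F t * φ t ∂circleMeasure = inner ℂ q (mulL F φ) := by
    rw [L2.inner_def]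
    refine integral_congr_ae ?_
    filter_upwards [coeFn_mulL F φ, indicatorConstLp_coeFn (p := 2) (hs := hs)
      (hμs := measure_ne_top circleMeasure s) (c := (1 : ℂ)), hF] with t h1 h2 h3
    rw [h1, h2]
    by_cases ht : t ∈ s
    · simp [ht]
    · have : F t = 0 := by simpa [ht] using h3
      simp [this]
  rw [hint, ← hq, ← mul_assoc]
  exact (hC F q).trans (by gcongr)

/-- An operator that commutes with the shift on `H²` is multiplication by a bounded function
there. -/
theorem exists_mulL_of_commutes {T : L2 →L[ℂ] L2}
    (hT : ∀ n : ℤ, 0 ≤ n → T (mono (n + 1)) = zpow 1 (T (mono n))) :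
    ∃ Φ : Linf, ∀ h ∈ hardy, T h = mulL Φ h := by
  have h1 : ∀ n : ℕ, T (mono n) = zpow n (T (mono 0)) := by
    intro n
    induction n with
    | zero => simp [zpow_zero]
    | succ n ih =>
      rw [Nat.cast_succ, hT _ (by positivity), ih, zpow_zpow, add_comm]
  have h2 : ∀ n : ℤ, 0 ≤ n → T (mono n) = zpow n (T (mono 0)) := by
    intro n hn
    lift n to ℕ using hn
    exact h1 n
  have hb : T (mono 0) ∈ bdd := by
    refine mem_bdd_of_shift_eq (T := T) fun s => ?_
    obtain ⟨m, hm⟩ := s.bddBelow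
    exact ⟨-m, fun j hj => h2 _ (by have := hm hj; omega)⟩
  refine ⟨toLinf hb, fun h hh => map_eq_on_hardy (fun n hn => ?_) hh⟩
  rw [h2 n hn, mulL_mono_eq, mulL_toLinf_mono_zero]

/-- A Brown–Halmos theorem: an operator into `H²₋` that intertwines the bilateral shift with the
compressed shift `P⁻ M_z` is `P⁻ M_Φ` for a bounded `Φ`. -/
theorem exists_projMinus_mulL {Y : L2 →L[ℂ] L2} (hY : ∀ f, projMinus (Y f) = Y f)
    (hz : ∀ f, Y (zpow 1 f) = projMinus (zpow 1 (Y f))) :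
    ∃ Φ : Linf, ∀ f, Y f = projMinus (mulL Φ f) := by
  set T : L2 →L[ℂ] L2 := ContinuousLinearMap.adjoint Y with hTdef
  have hT : ∀ n : ℤ, n < 0 → T (mono (n - 1)) = zpow (-1) (T (mono n)) := by
    intro n hn
    refine ext_inner_right ℂ fun f => ?_
    rw [inner_mulL, star_fourierLp, neg_neg, hTdef, ContinuousLinearMap.adjoint_inner_left,
      ContinuousLinearMap.adjoint_inner_left]
    change _ = inner ℂ _ (Y (zpow 1 f))
    rw [hz, ← inner_projMinus, projMinus_of_mem (mono_mem_hardyMinus hn), ← inner_conj_symm,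
      ← inner_conj_symm (mono n), inner_mulL, star_fourierLp]
    change _ = conj (inner ℂ (Y f) (zpow (-1) (mono n)))
    rw [zpow_mono]
    rw [show (-1 : ℤ) + n = n - 1 by ring]
  have h1 : ∀ n : ℕ, T (mono (-n - 1)) = zpow (-n - 1) (zpow 1 (T (mono (-1)))) := by
    intro n
    induction n with
    | zero => simp [zpow_zpow, zpow_zero]
    | succ n ih =>
      rw [Nat.cast_succ, show (-((n : ℤ) + 1) - 1) = (-n - 1) - 1 by ring, hT _ (by omega), ih,
        zpow_zpow (-1), show (-1 : ℤ) + (-n - 1) = -n - 1 - 1 by ring]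
  have h2 : ∀ n : ℤ, n < 0 → T (mono n) = zpow n (zpow 1 (T (mono (-1)))) := by
    intro n hn
    obtain ⟨k, rfl⟩ : ∃ k : ℕ, n = -k - 1 := ⟨(-n - 1).toNat, by omega⟩
    exact h1 k
  have hb : zpow 1 (T (mono (-1))) ∈ bdd := by
    refine mem_bdd_of_shift_eq (T := T) fun s => ?_
    obtain ⟨m, hm⟩ := s.bddAbove
    exact ⟨-m - 1, fun j hj => h2 _ (by have := hm hj; omega)⟩
  refine ⟨star (toLinf hb), fun f => ?_⟩
  refine ext_inner_left ℂ fun g => ?_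
  have h3 : T (projMinus g) = mulL (toLinf hb) (projMinus g) := by
    refine map_eq_on_hardyMinus (fun n hn => ?_) (projMinus_mem g)
    rw [h2 n hn, mulL_mono_eq, mulL_toLinf_mono_zero]
  rw [← inner_projMinus, ← inner_mulL, ← h3, hTdef, ContinuousLinearMap.adjoint_inner_left,
    inner_projMinus, hY]

/-! ### Factorization of analytic polynomials -/

section DiskAlgebra

open Polynomial Metric

/-- A polynomial factors on the unit circle as a product of two functions of the disk algebra with
equal moduli. -/
def HasBalancedFactorization (p : ℂ[X]) : Prop :=
  ∃ u v : ℂ → ℂ, DiffContOnCl ℂ u (ball 0 1) ∧ DiffContOnCl ℂ v (ball 0 1) ∧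
    ∀ z, ‖z‖ = 1 → p.eval z = u z * v z ∧ ‖u z‖ = ‖v z‖

theorem HasBalancedFactorization.mul {p q : ℂ[X]} (hp : HasBalancedFactorization p)
    (hq : HasBalancedFactorization q) : HasBalancedFactorization (p * q) := by
  obtain ⟨u, v, hu, hv, h⟩ := hp
  obtain ⟨u', v', hu', hv', h'⟩ := hq
  refine ⟨fun z => u z • u' z, fun z => v z • v' z, hu.smul hu', hv.smul hv', fun z hz => ⟨?_, ?_⟩⟩
  · rw [eval_mul, (h z hz).1, (h' z hz).1]; simp only [smul_eq_mul]; ring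
  · rw [norm_smul, norm_smul, (h z hz).2, (h' z hz).2]

theorem hasBalancedFactorization_C (c : ℂ) : HasBalancedFactorization (C c) := by
  obtain ⟨s, hs⟩ := IsAlgClosed.exists_pow_nat_eq c (n := 2) (by norm_num)
  exact ⟨fun _ => s, fun _ => s, diffContOnCl_const, diffContOnCl_const, fun z _ =>
    ⟨by rw [eval_C, ← hs, sq], rfl⟩⟩

theorem diffContOnCl_sqrt_one_sub {w : ℂ} (hw : ‖w‖ ≤ 1) :
    DiffContOnCl ℂ (fun z => (1 - w * z) ^ (1 / 2 : ℂ)) (ball 0 1) := by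
  have hre : ∀ z : ℂ, (w * z).re ≤ ‖z‖ := fun z =>
    (Complex.re_le_norm _).trans (by
      rw [norm_mul]; exact mul_le_of_le_one_left (norm_nonneg _) hw)
  refine ⟨fun z hz => ?_, fun z hz => ?_⟩
  · have hz' : ‖z‖ < 1 := by simpa using hz
    refine DifferentiableAt.differentiableWithinAt ?_
    refine DifferentiableAt.cpow_const (by fun_prop) (Or.inl ?_)
    have := hre z
    simp only [Complex.sub_re, Complex.one_re]
    linarith
  · rw [closure_ball _ one_ne_zero, mem_closedBall_zero_iff] at hz
    refine ContinuousAt.continuousWithinAt ?_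
    refine ContinuousAt.comp (f := fun z => 1 - w * z) (g := fun x => x ^ (1 / 2 : ℂ))
      (Complex.continuousAt_cpow_const_of_re_pos (Or.inl ?_) (by norm_num)) (by fun_prop)
    have := hre z
    simp only [Complex.sub_re, Complex.one_re]
    linarith

theorem sqrt_mul_sqrt (x : ℂ) : x ^ (1 / 2 : ℂ) * x ^ (1 / 2 : ℂ) = x := by
  rw [← sq, ← Complex.cpow_nat_mul]; norm_num

theorem hasBalancedFactorization_one_sub {w : ℂ} (hw : ‖w‖ ≤ 1) :
    HasBalancedFactorization (1 - C w * X) :=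
  ⟨_, _, diffContOnCl_sqrt_one_sub hw, diffContOnCl_sqrt_one_sub hw, fun z _ =>
    ⟨by simp only [sqrt_mul_sqrt]; simp, rfl⟩⟩

theorem hasBalancedFactorization_X_sub_C (a : ℂ) : HasBalancedFactorization (X - C a) := by
  rcases lt_or_ge ‖a‖ 1 with ha | ha
  · -- The zero `a` is moved into a Blaschke factor.
    have hw : ‖conj a‖ ≤ 1 := by rw [RCLike.norm_conj]; exact ha.le
    have h0 : ∀ z : ℂ, ‖z‖ ≤ 1 → 1 - conj a * z ≠ 0 := by
      intro z hz h
      have h1 : ‖conj a * z‖ = 1 := by rw [← sub_eq_zero.1 h, norm_one]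
      rw [norm_mul, RCLike.norm_conj] at h1
      nlinarith [norm_nonneg a, norm_nonneg z]
    refine ⟨fun z => ((z - a) / (1 - conj a * z)) • (1 - conj a * z) ^ (1 / 2 : ℂ),
      fun z => (1 - conj a * z) ^ (1 / 2 : ℂ), DiffContOnCl.smul ?_ (diffContOnCl_sqrt_one_sub hw),
      diffContOnCl_sqrt_one_sub hw, fun z hz => ⟨?_, ?_⟩⟩
    · refine DifferentiableOn.diffContOnCl fun z hz => ?_
      rw [closure_ball _ one_ne_zero, mem_closedBall_zero_iff] at hz
      exact (DifferentiableAt.div (c := fun z => z - a) (d := fun z => 1 - conj a * z) (by fun_prop)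
        (by fun_prop) (h0 z hz)).differentiableWithinAt
    · have := h0 z hz.le
      simp only [smul_eq_mul]
      rw [mul_assoc, sqrt_mul_sqrt, div_mul_cancel₀ _ this]; simp
    · have h1 : 1 - conj a * z = z * conj (z - a) := by
        rw [map_sub, mul_sub, Complex.mul_conj, Complex.normSq_eq_norm_sq, hz]; push_cast; ring
      have h2 : ‖(z - a) / (1 - conj a * z)‖ = 1 := by
        rw [norm_div]
        have h3 : ‖1 - conj a * z‖ = ‖z - a‖ := by
          rw [h1, norm_mul, RCLike.norm_conj, hz, one_mul]
        rw [← h3]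
        exact div_self (norm_ne_zero_iff.2 (h0 z hz.le))
      rw [norm_smul, h2, one_mul]
  · have ha0 : a ≠ 0 := by rintro rfl; norm_num at ha
    have h1 : (X - C a : ℂ[X]) = C (-a) * (1 - C a⁻¹ * X) := by
      have : (C a * C a⁻¹ : ℂ[X]) = 1 := by rw [← C_mul, mul_inv_cancel₀ ha0, C_1]
      rw [C_neg]
      linear_combination (-X) * this
    rw [h1]
    refine (hasBalancedFactorization_C _).mul (hasBalancedFactorization_one_sub ?_)
    rw [norm_inv]; exact inv_le_one_of_one_le₀ ha

theorem hasBalancedFactorization (p : ℂ[X]) : HasBalancedFactorization p := by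
  have h : ∀ s : Multiset ℂ, HasBalancedFactorization (s.map fun a => X - C a).prod := by
    intro s
    induction s using Multiset.induction_on with
    | empty => simpa using hasBalancedFactorization_C 1
    | cons a s ih =>
      rw [Multiset.map_cons, Multiset.prod_cons]
      exact (hasBalancedFactorization_X_sub_C a).mul ih
  rw [(IsAlgClosed.splits p).eq_prod_roots]
  exact (hasBalancedFactorization_C _).mul (h _)

/-! ### Boundary values of the disk algebra -/

theorem norm_fourier_apply (n : ℤ) (t : UnitAddCircle) : ‖fourier n t‖ = 1 := by
  rw [fourier_apply]; exact Circle.norm_coe _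

/-- The boundary values of a function of the disk algebra. -/
def boundary (u : ℂ → ℂ) (hu : DiffContOnCl ℂ u (ball 0 1)) : C(UnitAddCircle, ℂ) where
  toFun t := u (fourier 1 t)
  continuous_toFun := by
    have h := hu.continuousOn
    rw [closure_ball _ one_ne_zero] at h
    exact h.comp_continuous (map_continuous (fourier 1)) fun t => by
      rw [mem_closedBall_zero_iff, norm_fourier_apply]

theorem fourierCoeff_boundary {u : ℂ → ℂ} (hu : DiffContOnCl ℂ u (ball 0 1)) {n : ℤ} (hn : n < 0) :
    fourierCoeff (boundary u hu) n = 0 := by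
  obtain ⟨k, rfl⟩ : ∃ k : ℕ, n = -(k + 1 : ℕ) := ⟨(-n - 1).toNat, by omega⟩
  have hf : DiffContOnCl ℂ (fun z => z ^ (k + 1) • u z) (ball 0 |1|) := by
    rw [abs_one]
    exact ((Differentiable.diffContOnCl (by fun_prop)).smul hu)
  have h1 := hf.circleAverage
  have h2 : Real.circleAverage (fun z => z ^ (k + 1) • u z) 0 1 = 0 := by simpa using h1
  rw [fourierCoeff_eq_intervalIntegral _ _ 0, ← h2, Real.circleAverage]
  have h3 := intervalIntegral.integral_comp_mul_left (a := 0) (b := 1)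
    (fun θ => (fun z => z ^ (k + 1) • u z) (circleMap 0 1 θ)) (c := 2 * Real.pi) (by positivity)
  rw [mul_zero, mul_one] at h3
  rw [← h3, zero_add, div_one, one_smul]
  refine intervalIntegral.integral_congr fun x _ => ?_
  have h4 : ∀ n : ℤ, fourier n (x : UnitAddCircle) = circleMap 0 1 (2 * Real.pi * x) ^ n := by
    intro n
    rw [fourier_coe_apply, circleMap_zero, Complex.ofReal_one, one_mul, ← Complex.exp_int_mul]
    congr 1; push_cast; ring
  change fourier _ (x : UnitAddCircle) • u (fourier 1 (x : UnitAddCircle)) = _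
  rw [h4, h4, neg_neg, zpow_natCast, zpow_one]

/-- A continuous function on the circle as an element of `L^∞`. -/
abbrev contLinf (u : C(UnitAddCircle, ℂ)) : Linf := ContinuousMap.toLp ∞ circleMeasure ℂ u

theorem coeFn_contLinf (u : C(UnitAddCircle, ℂ)) : contLinf u =ᵐ[circleMeasure] u :=
  ContinuousMap.coeFn_toLp _ u

theorem contLinf_boundary_mem_hardy {u : ℂ → ℂ} (hu : DiffContOnCl ℂ u (ball 0 1)) :
    mulL (contLinf (boundary u hu)) (mono 0) ∈ hardy := by
  intro n hn
  rw [fourierCoeff_congr_ae ((coeFn_mulL_mono_zero _).trans (coeFn_contLinf _))]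
  exact fourierCoeff_boundary hu hn

/-! ### Nehari's theorem -/

/-- The Hahn–Banach theorem for a functional bounded by a seminorm pulled back along a linear
map. -/
theorem exists_dual_comp_eq {V E : Type*} [AddCommGroup V] [Module ℂ V] [NormedAddCommGroup E]
    [NormedSpace ℂ E] (ι : V →ₗ[ℂ] E) (l : V →ₗ[ℂ] ℂ) {C : ℝ} (hC : 0 ≤ C)
    (h : ∀ v, ‖l v‖ ≤ C * ‖ι v‖) :
    ∃ G : E →L[ℂ] ℂ, (∀ v, G (ι v) = l v) ∧ ∀ x, ‖G x‖ ≤ C * ‖x‖ := by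
  obtain ⟨σ, hσ⟩ := ι.rangeRestrict.exists_rightInverse_of_surjective ι.range_rangeRestrict
  have hσ' : ∀ y, ι (σ y) = y := fun y => congrArg Subtype.val (LinearMap.congr_fun hσ y)
  let f : StrongDual ℂ (LinearMap.range ι) := (l ∘ₗ σ).mkContinuous C fun y => by
    have := h (σ y)
    rwa [hσ'] at this
  obtain ⟨G, hG, hn⟩ := exists_extension_norm_eq _ f
  refine ⟨G, fun v => ?_, fun x => ?_⟩
  · have h1 := hG (ι.rangeRestrict v)
    change G (ι v) = l (σ (ι.rangeRestrict v)) at h1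
    have h2 := h (σ (ι.rangeRestrict v) - v)
    rw [map_sub ι, hσ', show ((ι.rangeRestrict v : LinearMap.range ι) : E) = ι v from rfl,
      sub_self, norm_zero, mul_zero, map_sub] at h2
    rw [h1]
    exact sub_eq_zero.1 (norm_le_zero_iff.1 h2)
  · refine (G.le_opNorm x).trans ?_
    gcongr
    rw [hn]
    exact LinearMap.mkContinuous_norm_le _ hC _

theorem inner_star_mono (g : L2) (n : ℤ) : inner ℂ (star g) (mono n) = coeff (-n) g := by
  rw [coeff_apply, L2.inner_def, L2.inner_def]
  refine integral_congr_ae ?_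
  filter_upwards [Lp.coeFn_star g, coeFn_fourierLp (T := 1) 2 n,
    coeFn_fourierLp (T := 1) 2 (-n)] with t h1 h2 h3
  rw [h1, h2, h3]
  simp only [RCLike.inner_apply, Pi.star_apply, RCLike.star_def, RCLike.conj_conj, fourier_neg]
  ring

theorem norm_star_L2 (g : L2) : ‖star g‖ = ‖g‖ := by
  rw [Lp.norm_def, Lp.norm_def]
  congr 1
  refine eLpNorm_congr_norm_ae ?_
  filter_upwards [Lp.coeFn_star g] with t h
  rw [h, Pi.star_apply, norm_star]

/-- The analytic polynomial `p(z)` as an element of `C(𝕋)`. -/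
def polyCont : ℂ[X] →ₗ[ℂ] C(UnitAddCircle, ℂ) := (aeval (fourier 1)).toLinearMap

theorem polyCont_apply (p : ℂ[X]) (t : UnitAddCircle) : polyCont p t = p.eval (fourier 1 t) := by
  have := aeval_algHom_apply (ContinuousMap.evalAlgHom ℂ ℂ t) (fourier 1) p
  rw [polyCont]
  change ContinuousMap.evalAlgHom ℂ ℂ t _ = _
  refine this.symm.trans ?_
  rw [coe_aeval_eq_eval]; rfl

theorem hankel_zpow {Γ : L2 →L[ℂ] L2} (hm : ∀ f, projMinus (Γ f) = Γ f)
    (hz : ∀ n : ℤ, 0 ≤ n → Γ (mono (n + 1)) = projMinus (zpow 1 (Γ (mono n))))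
    (n : ℕ) {f : L2} (hf : f ∈ hardy) :
    Γ (zpow n f) = projMinus (zpow n (Γ f)) := by
  have h1 : ∀ f ∈ hardy, Γ (zpow 1 f) = projMinus (zpow 1 (Γ f)) := by
    intro f hf
    refine map_eq_on_hardy (S := Γ ∘L zpow 1) (T := projMinus ∘L zpow 1 ∘L Γ) (fun n hn => ?_) hf
    change Γ (zpow 1 (mono n)) = projMinus (zpow 1 (Γ (mono n)))
    rw [zpow_mono, add_comm, hz n hn]
  induction n with
  | zero => rw [Nat.cast_zero, zpow_zero, zpow_zero, hm]
  | succ n ih =>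
    rw [Nat.cast_succ, add_comm, ← zpow_zpow, h1 _ (zpow_mem_hardy (by positivity) hf), ih,
      projMinus_zpow_projMinus zero_le_one, zpow_zpow]

theorem coeff_hankel_zpow {Γ : L2 →L[ℂ] L2} (hm : ∀ f, projMinus (Γ f) = Γ f)
    (hz : ∀ n : ℤ, 0 ≤ n → Γ (mono (n + 1)) = projMinus (zpow 1 (Γ (mono n))))
    (n : ℕ) {f : L2} (hf : f ∈ hardy) :
    coeff (-1) (Γ (zpow n f)) = coeff (-1 - n) (Γ f) := by
  rw [hankel_zpow hm hz n hf, coeff_projMinus (by norm_num), coeff_zpow]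

/-- The Hankel functional, which sends `f` to the coefficient of `Γ f` of index `-1`, is bounded on
products by the `L²` norms of the factors. -/
theorem norm_coeff_hankel_mul_le {Γ : L2 →L[ℂ] L2} (hm : ∀ f, projMinus (Γ f) = Γ f)
    (hz : ∀ n : ℤ, 0 ≤ n → Γ (mono (n + 1)) = projMinus (zpow 1 (Γ (mono n))))
    {u v : Linf} (hu : mulL u (mono 0) ∈ hardy)
    (hv : mulL v (mono 0) ∈ hardy) :
    ‖coeff (-1) (Γ (mulL u (mulL v (mono 0))))‖ ≤
      ‖Γ‖ * (‖mulL u (mono 0)‖ * ‖mulL v (mono 0)‖) := by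
  set g := Γ (mulL u (mono 0)) with hg
  have h : coeff (-1) (Γ (mulL u (mulL v (mono 0)))) =
      innerSL ℂ (zpow (-1) (star g)) (mulL v (mono 0)) := by
    refine map_eq_on_hardy (S := coeff (-1) ∘L Γ ∘L mulL u) (fun n hn => ?_) hv
    change coeff (-1) (Γ (mulL u (mono n))) = _
    lift n to ℕ using hn
    rw [mulL_mono_eq, coeff_hankel_zpow hm hz n hu, innerSL_apply_apply, inner_mulL,
      star_fourierLp, neg_neg]
    change _ = inner ℂ (star g) (zpow 1 (mono n))
    rw [zpow_mono, inner_star_mono, ← hg]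
    congr 1; ring_nf
  rw [h, innerSL_apply_apply, ← mul_assoc]
  refine (norm_inner_le_norm _ _).trans ?_
  rw [norm_zpow, norm_star_L2]
  gcongr
  exact Γ.le_opNorm _

/-- On analytic polynomials the Hankel functional is bounded by the `L¹` norm: this is where the
factorization enters. -/
theorem norm_coeff_hankel_poly_le {Γ : L2 →L[ℂ] L2} (hm : ∀ f, projMinus (Γ f) = Γ f)
    (hz : ∀ n : ℤ, 0 ≤ n → Γ (mono (n + 1)) = projMinus (zpow 1 (Γ (mono n))))
    (p : ℂ[X]) :
    ‖coeff (-1) (Γ (mulL (contLinf (polyCont p)) (mono 0)))‖ ≤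
      ‖Γ‖ * ‖ContinuousMap.toLp 1 circleMeasure ℂ (polyCont p)‖ := by
  obtain ⟨u, v, hu, hv, h⟩ := hasBalancedFactorization p
  set U := contLinf (boundary u hu) with hU
  set V := contLinf (boundary v hv) with hV
  have hp : mulL (contLinf (polyCont p)) (mono 0) = mulL U (mulL V (mono 0)) := by
    apply Lp.ext
    filter_upwards [(coeFn_mulL_mono_zero _).trans (coeFn_contLinf (polyCont p)),
      coeFn_mulL U (mulL V (mono 0)), coeFn_contLinf (boundary u hu),
      (coeFn_mulL_mono_zero _).trans (coeFn_contLinf (boundary v hv))] with t h1 h2 h3 h4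
    rw [h1, h2, h3, h4, polyCont_apply]
    exact (h _ (norm_fourier_apply 1 t)).1
  rw [hp]
  refine (norm_coeff_hankel_mul_le hm hz (contLinf_boundary_mem_hardy hu)
    (contLinf_boundary_mem_hardy hv)).trans (le_of_eq ?_)
  congr 1
  have h1 : ‖mulL V (mono 0)‖ = ‖mulL U (mono 0)‖ := by
    rw [Lp.norm_def, Lp.norm_def]
    congr 1
    refine eLpNorm_congr_norm_ae ?_
    filter_upwards [(coeFn_mulL_mono_zero _).trans (coeFn_contLinf (boundary u hu)),
      (coeFn_mulL_mono_zero _).trans (coeFn_contLinf (boundary v hv))] with t h1 h2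
    rw [h1, h2]
    exact (h _ (norm_fourier_apply 1 t)).2.symm
  have h2 : inner ℂ (mulL U (mono 0)) (mulL U (mono 0)) =
      ((∫ t, ‖ContinuousMap.toLp 1 circleMeasure ℂ (polyCont p) t‖ ∂circleMeasure : ℝ) : ℂ) := by
    rw [L2.inner_def, ← integral_complex_ofReal]
    refine integral_congr_ae ?_
    filter_upwards [(coeFn_mulL_mono_zero _).trans (coeFn_contLinf (boundary u hu)),
      ContinuousMap.coeFn_toLp (p := 1) (𝕜 := ℂ) circleMeasure (polyCont p)] with t h1 h2
    rw [h1, h2, polyCont_apply, (h _ (norm_fourier_apply 1 t)).1, norm_mul,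
      ← (h _ (norm_fourier_apply 1 t)).2, inner_self_eq_norm_sq_to_K]
    change ((‖u (fourier 1 t)‖ : ℝ) : ℂ) ^ 2 = _
    push_cast; ring
  rw [inner_self_eq_norm_sq_to_K] at h2
  rw [h1, L1.norm_eq_integral_norm, ← sq]
  exact Complex.ofReal_injective ((Complex.ofReal_pow _ _).trans h2)

/-- Nehari's theorem: a Hankel operator `H² → H²₋` is `P⁻ M_Φ` for a bounded `Φ`. -/
theorem exists_hankel_symbol {Γ : L2 →L[ℂ] L2} (hm : ∀ f, projMinus (Γ f) = Γ f)
    (hz : ∀ n : ℤ, 0 ≤ n → Γ (mono (n + 1)) = projMinus (zpow 1 (Γ (mono n)))) :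
    ∃ Φ : Linf, ∀ h ∈ hardy, Γ h = projMinus (mulL Φ h) := by
  -- The inclusion of `L²` into `L¹`.
  let J : L2 →L[ℂ] Lp ℂ 1 circleMeasure :=
    (ContinuousLinearMap.mul ℂ ℂ).holderL circleMeasure 2 2 1 (mono 0)
  have hJ : ∀ f : L2, J f =ᵐ[circleMeasure] f := by
    intro f
    filter_upwards [ContinuousLinearMap.coeFn_holder (r := 1) (ContinuousLinearMap.mul ℂ ℂ)
      (mono 0) f, coeFn_mono_zero] with t h1 h2
    refine h1.trans ?_
    rw [h2]; simp
  let A : ℂ[X] →ₗ[ℂ] L2 := (ContinuousMap.toLp 2 circleMeasure ℂ).toLinearMap ∘ₗ polyCont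
  have hA : ∀ p, A p = mulL (contLinf (polyCont p)) (mono 0) := by
    intro p
    apply Lp.ext
    filter_upwards [(coeFn_mulL_mono_zero _).trans (coeFn_contLinf (polyCont p)),
      ContinuousMap.coeFn_toLp (p := 2) (𝕜 := ℂ) circleMeasure (polyCont p)] with t h1 h2
    rw [h1]; exact h2
  have hJA : ∀ p, J (A p) = ContinuousMap.toLp 1 circleMeasure ℂ (polyCont p) := by
    intro p
    apply Lp.ext
    filter_upwards [hJ (A p), ContinuousMap.coeFn_toLp (p := 2) (𝕜 := ℂ) circleMeasure (polyCont p),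
      ContinuousMap.coeFn_toLp (p := 1) (𝕜 := ℂ) circleMeasure (polyCont p)] with t h1 h2 h3
    rw [h1, h3]; exact h2
  have hAX : ∀ n : ℕ, A (X ^ n) = mono n := by
    intro n
    apply Lp.ext
    filter_upwards [ContinuousMap.coeFn_toLp (p := 2) (𝕜 := ℂ) circleMeasure (polyCont (X ^ n)),
      coeFn_fourierLp (T := 1) 2 n] with t h1 h2
    refine h1.trans ?_
    rw [h2, polyCont_apply, eval_pow, eval_X, fourier_apply, fourier_apply, one_smul, natCast_zsmul,
      toCircle_nsmul, Circle.coe_pow]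
  obtain ⟨G, hG, hGn⟩ := exists_dual_comp_eq (J.toLinearMap ∘ₗ A)
    ((coeff (-1) ∘L Γ).toLinearMap ∘ₗ A) (norm_nonneg Γ) (fun p => by
      change ‖coeff (-1) (Γ (A p))‖ ≤ ‖Γ‖ * ‖J (A p)‖
      rw [hJA, hA]
      exact norm_coeff_hankel_poly_le hm hz p)
  set ψ : L2 := (InnerProductSpace.toDual ℂ L2).symm (G ∘L J) with hψ
  have hψG : ∀ f, inner ℂ ψ f = G (J f) := fun f => InnerProductSpace.toDual_symm_apply
  have hb : star ψ ∈ bdd := by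
    refine mem_bdd_of_forall_integral_le (C := ‖Γ‖) fun s F hs hF => ?_
    have h1 : ∫ t, F t * (star ψ : L2) t ∂circleMeasure = inner ℂ ψ (mulL F (mono 0)) := by
      rw [L2.inner_def]
      refine integral_congr_ae ?_
      filter_upwards [coeFn_mulL_mono_zero F, Lp.coeFn_star ψ] with t h1 h2
      rw [h1, h2]; rfl
    rw [h1, hψG]
    refine (hGn _).trans ?_
    gcongr
    rw [L1.norm_eq_integral_norm, ← integral_indicator_one hs]
    refine integral_mono_ae (L1.integrable_coeFn _).norm
      ((integrable_const (1 : ℝ)).indicator hs) ?_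
    filter_upwards [hJ (mulL F (mono 0)), coeFn_mulL_mono_zero F, hF] with t h1 h2 h3
    rw [h1, h2]; exact h3
  -- The coefficient of `Γ (z ^ n)` of index `-1 - j` is `∫ ψ̄ z ^ (n + j)`; the factor `z⁻¹` makes
  -- this the coefficient of the same index of `Φ z ^ n`.
  have hb' : zpow (-1) (star ψ) ∈ bdd := mulL_mem_bdd _ hb
  refine ⟨toLinf hb', fun h hh => ?_⟩
  refine map_eq_on_hardy (T := projMinus ∘L mulL (toLinf hb')) (fun n hn => ?_) hh
  lift n to ℕ using hn
  rw [ContinuousLinearMap.comp_apply, mulL_mono_eq, mulL_toLinf_mono_zero, ← hm]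
  refine ext_coeff fun k => ?_
  rcases lt_or_ge k 0 with hk | hk
  · obtain ⟨j, rfl⟩ : ∃ j : ℕ, k = -1 - j := ⟨(-k - 1).toNat, by omega⟩
    rw [hm, coeff_projMinus hk, ← coeff_hankel_zpow hm hz j (mono_mem_hardy (by positivity)),
      zpow_zpow, coeff_zpow, zpow_mono, ← Nat.cast_add, ← hAX]
    refine (hG (X ^ (j + n))).symm.trans ?_
    change G (J (A (X ^ (j + n)))) = _
    rw [← hψG, hAX, ← star_star ψ, inner_star_mono, star_star]
    congr 2; push_cast; ring
  · rw [coeff_projMinus_nonneg hk, coeff_projMinus_nonneg hk]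

end DiskAlgebra

/-! ### Block matrices in coordinates -/

theorem mulL_toLinf_mono (n : ℤ) (f : L2) : mulL (toLinf (mono_mem_bdd n)) f = zpow n f := by
  apply Lp.ext
  filter_upwards [coeFn_mulL (toLinf (mono_mem_bdd n)) f, coeFn_mulL (fourierLp ∞ n) f,
    coeFn_toLinf (mono_mem_bdd n), coeFn_fourierLp (T := 1) ∞ n,
    coeFn_fourierLp (T := 1) 2 n] with t h1 h2 h3 h4 h5
  rw [h1, h2, h3, h4, h5]

theorem mulL_toLinf_mulL (φ : Linf) {f : L2} (hf : f ∈ bdd) (hφf : mulL φ f ∈ bdd) (g : L2) :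
    mulL (toLinf hφf) g = mulL (toLinf hf) (mulL φ g) := by
  apply Lp.ext
  filter_upwards [coeFn_mulL (toLinf hφf) g, coeFn_mulL (toLinf hf) (mulL φ g), coeFn_mulL φ g,
    coeFn_toLinf hf, coeFn_toLinf hφf, coeFn_mulL φ f] with t h1 h2 h3 h4 h5 h6
  rw [h1, h2, h3, h4, h5, h6]; ring

theorem mulL_eq_mulL_toLinf (Φ : Linf) {f : L2} (hf : f ∈ bdd) :
    mulL Φ f = mulL (toLinf hf) (mulL Φ (mono 0)) := by
  rw [mulL_comm, mulL_toLinf_mono_zero]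

theorem projMinus_mulL_projMinus {h : L2} (hb : h ∈ bdd) (hh : h ∈ hardy) (f : L2) :
    projMinus (mulL (toLinf hb) (projMinus f)) = projMinus (mulL (toLinf hb) f) := by
  conv_rhs => rw [← projPlus_add_projMinus f]
  rw [map_add, map_add, projMinus_of_mem_hardy (mulL_toLinf_mem_hardy hb hh (projPlus_mem f)),
    zero_add]

theorem projPlus_mulL_projPlus {h : L2} (hb : h ∈ bdd) (hh : h ∈ hardyMinus) (f : L2) :
    projPlus (mulL (toLinf hb) (projPlus f)) = projPlus (mulL (toLinf hb) f) := by
  conv_rhs => rw [← projPlus_add_projMinus f]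
  rw [map_add, map_add,
    projPlus_of_mem_hardyMinus (mulL_toLinf_mem_hardyMinus hb hh (projMinus_mem f)), add_zero]

theorem coe_compress {X Y : Submodule ℂ L2} [Y.HasOrthogonalProjection] (φ : L2) {f : L2}
    (hf : f ∈ X ⊓ bdd) :
    (compress X Y φ ⟨f, hf⟩ : L2) = Y.starProjection (mulL (toLinf hf.2) φ) := by
  rw [← mulBdd_apply]; rfl

variable {θ α : InnerFunction} (D : θ.modelPerp →L[ℂ] α.modelPerp)

/-- The operator `D`, extended by zero on `K_θ` to an operator on `L²`. -/
def extend : L2 →L[ℂ] L2 :=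
  α.modelPerp.subtypeL ∘L D ∘L θ.modelPerp.orthogonalProjectionOnto

theorem extend_apply_of_mem {f : L2} (hf : f ∈ θ.modelPerp) : extend D f = D ⟨f, hf⟩ := by
  have : θ.modelPerp.orthogonalProjectionOnto f = ⟨f, hf⟩ :=
    Submodule.orthogonalProjectionOnto_mem_subspace_eq_self (⟨f, hf⟩ : θ.modelPerp)
  rw [← this]; rfl

theorem extend_mem (f : L2) : extend D f ∈ α.modelPerp := Subtype.property _

theorem comp_dualShift_eq_iff :
    D ∘L θ.dualShift = α.dualShift ∘L D ↔
      ∀ f ∈ θ.modelPerp, extend D (θ.shiftPerp f) = α.shiftPerp (extend D f) := by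
  have h : ∀ x : θ.modelPerp, ((D ∘L θ.dualShift) x : L2) = extend D (θ.shiftPerp x) ∧
      ((α.dualShift ∘L D) x : L2) = α.shiftPerp (extend D x) := by
    intro x
    constructor
    · rw [← θ.coe_dualShift, extend_apply_of_mem D (θ.dualShift x).2]; rfl
    · rw [extend_apply_of_mem D x.2, ← α.coe_dualShift]; rfl
  constructor
  · intro hD f hf
    rw [← (h ⟨f, hf⟩).1, ← (h ⟨f, hf⟩).2, hD]
  · intro hD
    refine ContinuousLinearMap.ext fun x => Subtype.ext ?_
    rw [(h x).1, (h x).2, hD x x.2]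

/-- The intertwining relation has to be checked only on the monomials `θ z ^ n`, `n ≥ 0`, and
`z ^ n`, `n < 0`. -/
theorem comp_dualShift_eq_of_mono
    (h1 : ∀ n : ℤ, 0 ≤ n →
      extend D (θ.mul (mono (n + 1))) = α.shiftPerp (extend D (θ.mul (mono n))))
    (h2 : ∀ n < 0, extend D (θ.shiftPerp (mono n)) = α.shiftPerp (extend D (mono n))) :
    D ∘L θ.dualShift = α.dualShift ∘L D := by
  rw [comp_dualShift_eq_iff]
  intro f hf
  have h3 : extend D (θ.shiftPerp (θ.mul (θ.coord f))) =
      α.shiftPerp (extend D (θ.mul (θ.coord f))) := by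
    refine map_eq_on_hardy (S := extend D ∘L θ.shiftPerp ∘L θ.mul)
      (T := α.shiftPerp ∘L extend D ∘L θ.mul) (fun n hn => ?_) (θ.coord_mem f)
    change extend D (θ.shiftPerp (θ.mul (mono n))) = α.shiftPerp (extend D (θ.mul (mono n)))
    rw [θ.shiftPerp_mul (mono_mem_hardy hn), zpow_mono, add_comm, h1 n hn]
  have h4 : extend D (θ.shiftPerp (projMinus f)) = α.shiftPerp (extend D (projMinus f)) :=
    map_eq_on_hardyMinus (S := extend D ∘L θ.shiftPerp) (T := α.shiftPerp ∘L extend D) h2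
      (projMinus_mem f)
  rw [← θ.projPerp_of_mem hf, θ.projPerp_apply]
  simp only [map_add, h3, h4]

/-- The block matrix in terms of the operators `h ↦ D(θ h)` on `H²` and `g ↦ D g` on `H²₋`. -/
theorem hasBlockMatrix_iff (ψ₁ ψ₂ ψ₃ ψ₄ : L2) :
    HasBlockMatrix D ψ₁ ψ₂ ψ₃ ψ₄ ↔
      (∀ (h : L2) (hb : h ∈ bdd), h ∈ hardy → extend D (θ.mul h) =
        α.mul (projPlus (mulL (toLinf hb) (α.mulConj (θ.mul ψ₁)))) +
          projMinus (mulL (toLinf hb) (θ.mul ψ₃))) ∧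
      (∀ (g : L2) (hb : g ∈ bdd), g ∈ hardyMinus → extend D g =
        α.mul (projPlus (mulL (toLinf hb) (α.mulConj ψ₂))) +
          projMinus (mulL (toLinf hb) ψ₄)) := by
  have e1 : ∀ (h : L2) (hb : h ∈ bdd) (hf : θ.mul h ∈ θ.range ⊓ bdd),
      (toeplitzHat θ α ψ₁ ⟨θ.mul h, hf⟩ : L2) + hankelHat θ ψ₃ ⟨θ.mul h, hf⟩ =
        α.mul (projPlus (mulL (toLinf hb) (α.mulConj (θ.mul ψ₁)))) +
          projMinus (mulL (toLinf hb) (θ.mul ψ₃)) := by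
    intro h hb hf
    have h1 : ∀ g, mulL (toLinf hf.2) g = mulL (toLinf hb) (θ.mul g) :=
      mulL_toLinf_mulL θ.toLinf hb hf.2
    rw [toeplitzHat, hankelHat, coe_compress, coe_compress, α.starProjection_range, h1, h1,
      InnerFunction.mulConj, mulL_comm]
    rfl
  have e2 : ∀ (g : L2) (hf : g ∈ hardyMinus ⊓ bdd),
      (hankelCheck α ψ₂ ⟨g, hf⟩ : L2) + toeplitzCheck ψ₄ ⟨g, hf⟩ =
        α.mul (projPlus (mulL (toLinf hf.2) (α.mulConj ψ₂))) +
          projMinus (mulL (toLinf hf.2) ψ₄) := by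
    intro g hf
    rw [hankelCheck, toeplitzCheck, coe_compress, coe_compress, α.starProjection_range,
      InnerFunction.mulConj, mulL_comm]
    rfl
  constructor
  · rintro ⟨c1, c2⟩
    refine ⟨fun h hb hh => ?_, fun g hb hg => ?_⟩
    · have hf : θ.mul h ∈ θ.range ⊓ bdd := ⟨θ.mul_mem_range hh, mulL_mem_bdd _ hb⟩
      rw [← e1 h hb hf, ← c1 ⟨θ.mul h, hf⟩, extend_apply_of_mem]
    · have hf : g ∈ hardyMinus ⊓ bdd := ⟨hg, hb⟩
      rw [← e2 g hf, ← c2 ⟨g, hf⟩, extend_apply_of_mem]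
  · rintro ⟨c1, c2⟩
    refine ⟨fun f => ?_, fun f => ?_⟩
    · obtain ⟨_, ⟨h, hh, rfl⟩, hf⟩ := f
      have hb : h ∈ bdd := by
        rw [← θ.mulConj_mul h]; exact mulL_mem_bdd _ hf
      change ((D ⟨θ.mul h, _⟩ : α.modelPerp) : L2) = _
      rw [← extend_apply_of_mem, c1 h hb hh]
      exact (e1 h hb ⟨θ.mul_mem_range hh, hf⟩).symm
    · obtain ⟨g, hg, hb⟩ := f
      change ((D ⟨g, _⟩ : α.modelPerp) : L2) = _
      rw [← extend_apply_of_mem, c2 g hb hg]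
      exact (e2 g ⟨hg, hb⟩).symm

/-! ### The case `θ(0) ≠ 0` -/

/-- When `θ(0) ≠ 0`, the four prescribed entries combine into the single relation
`D X_θ = X_α M_ψ`, where `X_θ` and `X_α` are the transfer operators. -/
theorem hasBlockMatrix_iff_of_eval_ne_zero (hθ0 : θ.eval 0 ≠ 0) (ψ : L2) :
    HasBlockMatrix D ((conj (α.eval 0) / conj (θ.eval 0)) • α.mul (θ.mulConj ψ))
      (conj (α.eval 0) • α.mul (projPlus ψ)) ((1 / conj (θ.eval 0)) • θ.mulConj (projMinus ψ)) ψ ↔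
      (∀ (h : L2) (hb : h ∈ bdd), h ∈ hardy ∨ h ∈ hardyMinus →
        extend D (θ.transfer h) = α.transfer (mulL (toLinf hb) ψ)) := by
  have ht : conj (θ.eval 0) ≠ 0 := by simpa using hθ0
  have e1 : ∀ (h : L2) (hb : h ∈ bdd), h ∈ hardy →
      (extend D (θ.mul h) = α.mul (projPlus (mulL (toLinf hb) (α.mulConj (θ.mul
          ((conj (α.eval 0) / conj (θ.eval 0)) • α.mul (θ.mulConj ψ)))))) +
        projMinus (mulL (toLinf hb) (θ.mul ((1 / conj (θ.eval 0)) • θ.mulConj (projMinus ψ)))) ↔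
      extend D (θ.transfer h) = α.transfer (mulL (toLinf hb) ψ)) := by
    intro h hb hh
    have h1 : α.mulConj (θ.mul (α.mul (θ.mulConj ψ))) = ψ := by
      rw [InnerFunction.mul, InnerFunction.mul, mulL_comm]
      exact (α.mulConj_mul _).trans (θ.mul_mulConj ψ)
    simp only [map_smul, h1, θ.mul_mulConj, projMinus_mulL_projMinus hb hh]
    rw [θ.transfer_of_mem_hardy hh, map_smul, α.transfer_apply, ← eq_inv_smul_iff₀ ht, smul_add,
      smul_smul, one_div, div_eq_inv_mul, add_comm]
  have e2 : ∀ (g : L2) (hb : g ∈ bdd), g ∈ hardyMinus →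
      (extend D g = α.mul (projPlus (mulL (toLinf hb) (α.mulConj
          (conj (α.eval 0) • α.mul (projPlus ψ))))) + projMinus (mulL (toLinf hb) ψ) ↔
      extend D (θ.transfer g) = α.transfer (mulL (toLinf hb) ψ)) := by
    intro g hb hg
    simp only [map_smul, α.mulConj_mul, projPlus_mulL_projPlus hb hg]
    rw [θ.transfer_of_mem_hardyMinus hg, α.transfer_apply, add_comm]
  rw [hasBlockMatrix_iff]
  constructor
  · rintro ⟨c1, c2⟩ h hb (hh | hh)
    · exact (e1 h hb hh).1 (c1 h hb hh)
    · exact (e2 h hb hh).1 (c2 h hb hh)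
  · exact fun c => ⟨fun h hb hh => (e1 h hb hh).2 (c h hb (Or.inl hh)),
      fun h hb hh => (e2 h hb hh).2 (c h hb (Or.inr hh))⟩

/-- An operator that commutes with the bilateral shift and maps into `H²` vanishes. -/
theorem eq_zero_of_commutes_of_mem_hardy {R : L2 →L[ℂ] L2} (hR : ∀ f, R f ∈ hardy)
    (hz : ∀ f, R (zpow 1 f) = zpow 1 (R f)) (f : L2) : R f = 0 := by
  have h1 : ∀ (m : ℕ) f, R (zpow m f) = zpow m (R f) := by
    intro m
    induction m with
    | zero => intro f; simp [zpow_zero]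
    | succ m ih =>
      intro f
      rw [Nat.cast_succ, add_comm, ← zpow_zpow, ← zpow_zpow, hz, ih]
  refine ext_coeff fun n => ?_
  rw [map_zero]
  -- `R f = z ^ m R(z ^ (-m) f)` has no Fourier coefficients of index below `m`.
  have h2 : R f = zpow ((n.toNat + 1 : ℕ) : ℤ) (R (zpow (-((n.toNat + 1 : ℕ) : ℤ)) f)) := by
    rw [← h1, zpow_zpow, add_neg_cancel, zpow_zero]
  rw [h2, coeff_zpow]
  exact mem_hardy.1 (hR _) _ (by omega)

/-- An intertwiner `D` satisfies `D X_θ = X_α M_Φ` for a bounded `Φ`, whatever `θ(0)` and `α(0)`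
are. -/
theorem exists_symbol_of_comp_dualShift_eq (hD : D ∘L θ.dualShift = α.dualShift ∘L D) :
    ∃ Φ : Linf, ∀ f, extend D (θ.transfer f) = α.transfer (mulL Φ f) := by
  rw [comp_dualShift_eq_iff] at hD
  have hY : ∀ f, extend D (θ.transfer (zpow 1 f)) = α.shiftPerp (extend D (θ.transfer f)) := by
    intro f
    rw [← θ.shiftPerp_transfer, hD _ (θ.transfer_mem f)]
  obtain ⟨Φ, hΦ⟩ := exists_projMinus_mulL (Y := projMinus ∘L extend D ∘L θ.transfer)
    (fun f => projMinus_of_mem (projMinus_mem _)) (fun f => by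
      change projMinus (extend D (θ.transfer (zpow 1 f))) = projMinus (zpow 1 (projMinus _))
      rw [hY, α.projMinus_shiftPerp]; rfl)
  replace hΦ : ∀ f, projMinus (extend D (θ.transfer f)) = projMinus (mulL Φ f) := hΦ
  refine ⟨Φ, fun f => ?_⟩
  have hR := eq_zero_of_commutes_of_mem_hardy
    (R := α.coord ∘L extend D ∘L θ.transfer - conj (α.eval 0) • (projPlus ∘L mulL Φ))
    (fun f => sub_mem (α.coord_mem _) (Submodule.smul_mem _ _ (projPlus_mem _))) (fun f => by
      change α.coord (extend D (θ.transfer (zpow 1 f))) -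
          conj (α.eval 0) • projPlus (mulL Φ (zpow 1 f)) =
        zpow 1 (α.coord (extend D (θ.transfer f)) - conj (α.eval 0) • projPlus (mulL Φ f))
      rw [hY, α.coord_shiftPerp (extend_mem D _), mulL_comm, projPlus_zpow_one,
        ← coeff_projMinus (by norm_num) (extend D _), hΦ, coeff_projMinus (by norm_num), map_sub,
        map_smul, smul_add, smul_smul]
      abel) f
  refine α.eq_of_coord (extend_mem D _) (α.transfer_mem _) ?_ ?_
  · rw [α.coord_transfer]; exact sub_eq_zero.1 hR
  · rw [hΦ, α.projMinus_transfer]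

theorem comp_dualShift_eq_iff_of_eval_ne_zero (hθ0 : θ.eval 0 ≠ 0) :
    D ∘L θ.dualShift = α.dualShift ∘L D ↔ ∃ ψ ∈ bdd,
      HasBlockMatrix D ((conj (α.eval 0) / conj (θ.eval 0)) • α.mul (θ.mulConj ψ))
        (conj (α.eval 0) • α.mul (projPlus ψ))
        ((1 / conj (θ.eval 0)) • θ.mulConj (projMinus ψ)) ψ := by
  simp only [hasBlockMatrix_iff_of_eval_ne_zero D hθ0]
  constructor
  · intro hD
    obtain ⟨Φ, hΦ⟩ := exists_symbol_of_comp_dualShift_eq D hD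
    refine ⟨_, mulL_mono_zero_mem_bdd Φ, fun h hb _ => ?_⟩
    rw [hΦ, mulL_eq_mulL_toLinf Φ hb]
  · rintro ⟨ψ, hψ, h⟩
    have h1 : extend D ∘L θ.transfer = α.transfer ∘L mulL (toLinf hψ) := by
      refine map_ext_mono fun n => ?_
      rw [ContinuousLinearMap.comp_apply, ContinuousLinearMap.comp_apply,
        h _ (mono_mem_bdd n) ((le_or_gt 0 n).imp mono_mem_hardy mono_mem_hardyMinus),
        mulL_toLinf_comm]
    have h2 : ∀ f, extend D (θ.transfer f) = α.transfer (mulL (toLinf hψ) f) :=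
      fun f => DFunLike.congr_fun h1 f
    have h3 : ∀ f, extend D (θ.shiftPerp (θ.transfer f)) =
        α.shiftPerp (extend D (θ.transfer f)) := by
      intro f
      rw [θ.shiftPerp_transfer, h2, h2, α.shiftPerp_transfer, mulL_comm]
    have ht : conj (θ.eval 0) ≠ 0 := by simpa using hθ0
    refine comp_dualShift_eq_of_mono D (fun n hn => ?_) (fun n hn => ?_)
    · have h4 := h3 (mono n)
      rw [θ.transfer_of_mem_hardy (mono_mem_hardy hn), map_smul, map_smul, map_smul, map_smul,
        θ.shiftPerp_mul (mono_mem_hardy hn), zpow_mono, add_comm] at h4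
      exact smul_right_injective _ ht h4
    · rw [← θ.transfer_of_mem_hardyMinus (mono_mem_hardyMinus hn)]
      exact h3 _

/-! ### The case `θ(0) = 0` -/

/-- When `θ(0) = 0`, an operator that turns `D_z^θ` into multiplication by `z` vanishes on `H²₋`,
where `D_z^θ` is nilpotent on each monomial. -/
theorem map_hardyMinus_eq_zero (hθ0 : θ.eval 0 = 0) {Z : L2 →L[ℂ] L2}
    (hZ : ∀ f ∈ θ.modelPerp, Z (θ.shiftPerp f) = zpow 1 (Z f)) {f : L2} (hf : f ∈ hardyMinus) :
    Z f = 0 := by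
  have h0 : ∀ f, zpow 1 f = 0 → f = 0 := by
    intro f h
    rw [← zpow_neg_zpow 1 f, h, map_zero]
  have h1 : ∀ n : ℕ, Z (mono (-n - 1)) = 0 := by
    intro n
    refine h0 _ ?_
    rw [← hZ _ (θ.hardyMinus_le_modelPerp (mono_mem_hardyMinus (by omega)))]
    induction n with
    | zero =>
      rw [Nat.cast_zero, neg_zero, zero_sub, θ.shiftPerp_mono_neg_one, hθ0, map_zero, zero_smul,
        map_zero]
    | succ n ih =>
      rw [θ.shiftPerp_mono (by omega),
        show (-((n + 1 : ℕ) : ℤ) - 1 + 1) = -n - 1 by push_cast; ring]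
      refine h0 _ ?_
      rw [← hZ _ (θ.hardyMinus_le_modelPerp (mono_mem_hardyMinus (by omega))), ih]
  refine map_eq_on_hardyMinus (T := 0) (fun n hn => ?_) hf
  obtain ⟨k, rfl⟩ : ∃ k : ℕ, n = -k - 1 := ⟨(-n - 1).toNat, by omega⟩
  exact h1 k

theorem hasBlockMatrix_iff_of_eval_eq_zero_of_ne_zero (hα0 : α.eval 0 ≠ 0) (ψ : L2) :
    HasBlockMatrix D ψ 0 ((1 / conj (α.eval 0)) •
        θ.mulConj (projMinus (α.mulConj (θ.mul ψ)))) 0 ↔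
      (∀ (h : L2) (hb : h ∈ bdd), h ∈ hardy → extend D (θ.mul h) =
        (conj (α.eval 0))⁻¹ • α.transfer (mulL (toLinf hb) (α.mulConj (θ.mul ψ)))) ∧
      (∀ g ∈ bdd, g ∈ hardyMinus → extend D g = 0) := by
  have hs : conj (α.eval 0) ≠ 0 := by simpa using hα0
  rw [hasBlockMatrix_iff]
  refine and_congr (forall₃_congr fun h hb hh => ?_) (forall₃_congr fun g hb hg => ?_)
  · simp only [map_smul, θ.mul_mulConj, projMinus_mulL_projMinus hb hh]
    rw [α.transfer_apply, smul_add, smul_smul, inv_mul_cancel₀ hs, one_smul, one_div, add_comm]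
  · simp only [map_zero, add_zero]

theorem comp_dualShift_eq_iff_of_eval_eq_zero_of_ne_zero (hθ0 : θ.eval 0 = 0)
    (hα0 : α.eval 0 ≠ 0) :
    D ∘L θ.dualShift = α.dualShift ∘L D ↔ ∃ ψ ∈ bdd,
      HasBlockMatrix D ψ 0 ((1 / conj (α.eval 0)) •
        θ.mulConj (projMinus (α.mulConj (θ.mul ψ)))) 0 := by
  have hs : conj (α.eval 0) ≠ 0 := by simpa using hα0
  simp only [hasBlockMatrix_iff_of_eval_eq_zero_of_ne_zero D hα0]
  constructor
  · intro hD
    rw [comp_dualShift_eq_iff] at hD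
    -- On `K_α^⊥` the operator `V` is the inverse of `α.transfer`.
    let V : L2 →L[ℂ] L2 := projMinus + (conj (α.eval 0))⁻¹ • α.coord
    have hV : ∀ f, V f = projMinus f + (conj (α.eval 0))⁻¹ • α.coord f := fun f => rfl
    have hVs : ∀ f ∈ α.modelPerp, V (α.shiftPerp f) = zpow 1 (V f) := by
      intro f hf
      have h1 := projPlus_zpow_one (projMinus f)
      rw [projPlus_of_mem_hardyMinus (projMinus_mem f), map_zero, zero_add,
        coeff_projMinus (by norm_num)] at h1
      rw [hV, hV, α.projMinus_shiftPerp, α.coord_shiftPerp hf, map_add, map_smul, smul_add,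
        smul_smul, inv_mul_cancel_left₀ hs, ← h1]
      conv_rhs => rw [← projPlus_add_projMinus (zpow 1 (projMinus f))]
      abel
    have hVt : ∀ f ∈ α.modelPerp, α.transfer (V f) = f := by
      intro f hf
      have h1 : projMinus ((conj (α.eval 0))⁻¹ • α.coord f) = 0 :=
        projMinus_of_mem_hardy (Submodule.smul_mem _ _ (α.coord_mem f))
      refine α.eq_of_coord (α.transfer_mem _) hf ?_ ?_
      · rw [α.coord_transfer, hV, map_add, projPlus_of_mem_hardyMinus (projMinus_mem f), zero_add,
          map_smul, projPlus_of_mem (α.coord_mem f), smul_smul, mul_inv_cancel₀ hs, one_smul]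
      · rw [α.projMinus_transfer, hV, map_add, h1, add_zero, projMinus_of_mem (projMinus_mem f)]
    have hZ : ∀ f ∈ θ.modelPerp, (V ∘L extend D) (θ.shiftPerp f) = zpow 1 ((V ∘L extend D) f) := by
      intro f hf
      change V (extend D (θ.shiftPerp f)) = zpow 1 (V (extend D f))
      rw [hD f hf, hVs _ (extend_mem D f)]
    obtain ⟨Φ, hΦ⟩ := exists_mulL_of_commutes (T := V ∘L extend D ∘L θ.mul) (fun n hn => by
      have h1 := hZ _ (θ.range_le_modelPerp (θ.mul_mem_range (mono_mem_hardy hn)))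
      rwa [θ.shiftPerp_mul (mono_mem_hardy hn), zpow_mono, add_comm] at h1)
    set φ := mulL Φ (mono 0) with hφ
    have h2 : α.mulConj (θ.mul (conj (α.eval 0) • α.mul (θ.mulConj φ))) =
        conj (α.eval 0) • φ := by
      rw [map_smul, map_smul, InnerFunction.mul, InnerFunction.mul, mulL_comm]
      exact congrArg _ ((α.mulConj_mul _).trans (θ.mul_mulConj φ))
    refine ⟨conj (α.eval 0) • α.mul (θ.mulConj φ), Submodule.smul_mem _ _
      (mulL_mem_bdd _ (mulL_mem_bdd _ (mulL_mono_zero_mem_bdd Φ))), fun h hb hh => ?_,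
      fun g hb hg => ?_⟩
    · rw [h2, map_smul, map_smul, smul_smul, inv_mul_cancel₀ hs, one_smul, hφ,
        ← mulL_eq_mulL_toLinf Φ hb, ← hΦ h hh]
      exact (hVt _ (extend_mem D _)).symm
    · rw [← hVt _ (extend_mem D g)]
      have := map_hardyMinus_eq_zero hθ0 hZ hg
      rw [ContinuousLinearMap.comp_apply] at this
      rw [this, map_zero]
  · rintro ⟨ψ, -, h1, h2⟩
    refine comp_dualShift_eq_of_mono D (fun n hn => ?_) (fun n hn => ?_)
    · rw [h1 _ (mono_mem_bdd _) (mono_mem_hardy hn),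
        h1 _ (mono_mem_bdd _) (mono_mem_hardy (by omega)), map_smul, α.shiftPerp_transfer,
        mulL_toLinf_mono, mulL_toLinf_mono, zpow_zpow, add_comm]
    · rw [h2 _ (mono_mem_bdd n) (mono_mem_hardyMinus hn), map_zero]
      rcases eq_or_lt_of_le (show n ≤ -1 by omega) with rfl | hn'
      · rw [θ.shiftPerp_mono_neg_one, hθ0, map_zero, zero_smul, map_zero]
      · rw [θ.shiftPerp_mono hn', h2 _ (mono_mem_bdd _) (mono_mem_hardyMinus (by omega))]

theorem hasBlockMatrix_iff_of_eval_eq_zero {h₁ ψ₄ : L2} (hh₁ : h₁ ∈ hardy) (ψ₃ : L2) :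
    HasBlockMatrix D (α.mul (θ.mulConj h₁)) 0 ψ₃ ψ₄ ↔
      (∀ (h : L2) (hb : h ∈ bdd), h ∈ hardy → extend D (θ.mul h) =
        α.mul (mulL (toLinf hb) h₁) + projMinus (mulL (toLinf hb) (θ.mul ψ₃))) ∧
      (∀ (g : L2) (hb : g ∈ bdd), g ∈ hardyMinus →
        extend D g = projMinus (mulL (toLinf hb) ψ₄)) := by
  rw [hasBlockMatrix_iff]
  refine and_congr (forall₃_congr fun h hb hh => ?_) (forall₃_congr fun g hb hg => ?_)
  · have h1 : α.mulConj (θ.mul (α.mul (θ.mulConj h₁))) = h₁ := by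
      rw [InnerFunction.mul, InnerFunction.mul, mulL_comm]
      exact (α.mulConj_mul _).trans (θ.mul_mulConj h₁)
    rw [h1, projPlus_of_mem (mulL_toLinf_mem_hardy hb hh hh₁)]
  · simp only [map_zero, zero_add]

theorem comp_dualShift_eq_iff_of_eval_eq_zero (hθ0 : θ.eval 0 = 0) (hα0 : α.eval 0 = 0) :
    D ∘L θ.dualShift = α.dualShift ∘L D ↔
      ∃ h₁ ∈ hardyInf, ∃ ψ₃ ∈ bdd, ∃ ψ₄ ∈ hardyInf,
        HasBlockMatrix D (α.mul (θ.mulConj h₁)) 0 ψ₃ ψ₄ := by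
  -- As `α(0) = 0`, nothing crosses over from `H²₋` to `αH²`.
  have hco : ∀ f ∈ α.modelPerp, α.coord (α.shiftPerp f) = zpow 1 (α.coord f) := by
    intro f hf
    rw [α.coord_shiftPerp hf, hα0, map_zero, zero_mul, zero_smul, add_zero]
  have hmem : ∀ {n : ℤ}, 0 ≤ n → θ.mul (mono n) ∈ θ.modelPerp := fun hn =>
    θ.range_le_modelPerp (θ.mul_mem_range (mono_mem_hardy hn))
  constructor
  · intro hD
    rw [comp_dualShift_eq_iff] at hD
    have hDθ : ∀ n : ℤ, 0 ≤ n →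
        extend D (θ.mul (mono (n + 1))) = α.shiftPerp (extend D (θ.mul (mono n))) := by
      intro n hn
      rw [← hD _ (hmem hn), θ.shiftPerp_mul (mono_mem_hardy hn), zpow_mono, add_comm]
    obtain ⟨Φ₁, hΦ₁⟩ := exists_mulL_of_commutes (T := α.coord ∘L extend D ∘L θ.mul) (fun n hn => by
      change α.coord (extend D (θ.mul (mono (n + 1)))) =
        zpow 1 (α.coord (extend D (θ.mul (mono n))))
      rw [hDθ n hn, hco _ (extend_mem D _)])
    obtain ⟨Φ₃, hΦ₃⟩ := exists_hankel_symbol (Γ := projMinus ∘L extend D ∘L θ.mul)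
      (fun f => projMinus_of_mem (projMinus_mem _)) (fun n hn => by
        change projMinus (extend D (θ.mul (mono (n + 1)))) =
          projMinus (zpow 1 (projMinus (extend D (θ.mul (mono n)))))
        rw [hDθ n hn, α.projMinus_shiftPerp])
    obtain ⟨Φ₄, hΦ₄⟩ := exists_projMinus_mulL (Y := projMinus ∘L extend D ∘L projMinus)
      (fun f => projMinus_of_mem (projMinus_mem _)) (fun f => by
        change projMinus (extend D (projMinus (zpow 1 f))) =
          projMinus (zpow 1 (projMinus (extend D (projMinus f))))
        rw [← α.projMinus_shiftPerp, ← hD _ (θ.hardyMinus_le_modelPerp (projMinus_mem f))]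
        congr 2
        refine θ.eq_of_coord (θ.hardyMinus_le_modelPerp (projMinus_mem _)) (θ.projPerp_mem _) ?_ ?_
        · rw [θ.coord_of_mem_hardyMinus (projMinus_mem _),
            θ.coord_shiftPerp (θ.hardyMinus_le_modelPerp (projMinus_mem f)), hθ0,
            θ.coord_of_mem_hardyMinus (projMinus_mem _)]
          simp
        · rw [θ.projMinus_shiftPerp, projMinus_of_mem (projMinus_mem _),
            projMinus_zpow_projMinus zero_le_one, projMinus_zpow_projMinus zero_le_one])
    -- The entry from `H²₋` to `αH²` vanishes.
    have hz : ∀ g ∈ hardyMinus, α.coord (extend D g) = 0 := by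
      intro g hg
      refine map_hardyMinus_eq_zero hθ0 (Z := α.coord ∘L extend D) (fun f hf => ?_) hg
      change α.coord (extend D (θ.shiftPerp f)) = zpow 1 (α.coord (extend D f))
      rw [hD f hf, hco _ (extend_mem D f)]
    have hdec : ∀ f, extend D f = α.mul (α.coord (extend D f)) + projMinus (extend D f) := by
      intro f
      conv_lhs => rw [← α.projPerp_of_mem (extend_mem D f), α.projPerp_apply]
    have hh₁ : mulL Φ₁ (mono 0) ∈ hardy := by
      rw [← hΦ₁ _ (mono_mem_hardy le_rfl)]; exact α.coord_mem _
    -- The operator with symbol `Φ₄` was extended by zero to `H²`, so `P⁻ Φ₄ = 0`.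
    have hψ₄ : mulL Φ₄ (mono 0) ∈ hardy := by
      rw [← projMinus_eq_zero_iff, ← hΦ₄]
      change projMinus (extend D (projMinus (mono 0))) = 0
      rw [projMinus_of_mem_hardy (mono_mem_hardy le_rfl), map_zero, map_zero]
    refine ⟨_, ⟨hh₁, mulL_mono_zero_mem_bdd Φ₁⟩, θ.mulConj (mulL Φ₃ (mono 0)),
      mulL_mem_bdd _ (mulL_mono_zero_mem_bdd Φ₃), _, ⟨hψ₄, mulL_mono_zero_mem_bdd Φ₄⟩, ?_⟩
    refine (hasBlockMatrix_iff_of_eval_eq_zero D hh₁ _).2 ⟨fun h hb hh => ?_, fun g hb hg => ?_⟩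
    · rw [θ.mul_mulConj, ← mulL_eq_mulL_toLinf, ← mulL_eq_mulL_toLinf, ← hΦ₁ h hh, ← hΦ₃ h hh]
      exact hdec _
    · rw [← mulL_eq_mulL_toLinf, ← hΦ₄, hdec, hz g hg, map_zero, zero_add]
      change projMinus (extend D g) = projMinus (extend D (projMinus g))
      rw [projMinus_of_mem hg]
  · rintro ⟨h₁, hh₁, ψ₃, -, ψ₄, hψ₄, hB⟩
    obtain ⟨c1, c2⟩ := (hasBlockMatrix_iff_of_eval_eq_zero D hh₁.1 ψ₃).1 hB
    have hsm : ∀ f, α.shiftPerp (projMinus f) = projMinus (zpow 1 f) := by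
      intro f
      refine α.eq_of_coord (α.projPerp_mem _) (α.hardyMinus_le_modelPerp (projMinus_mem _)) ?_ ?_
      · rw [hco _ (α.hardyMinus_le_modelPerp (projMinus_mem f)),
          α.coord_of_mem_hardyMinus (projMinus_mem _), map_zero,
          α.coord_of_mem_hardyMinus (projMinus_mem _)]
      · rw [α.projMinus_shiftPerp, projMinus_of_mem (projMinus_mem f),
          projMinus_zpow_projMinus zero_le_one, projMinus_of_mem (projMinus_mem _)]
    have hc2 : ∀ n < 0, extend D (mono n) = projMinus (zpow n ψ₄) := by
      intro n hn
      rw [c2 _ (mono_mem_bdd n) (mono_mem_hardyMinus hn), mulL_toLinf_mono]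
    refine comp_dualShift_eq_of_mono D (fun n hn => ?_) (fun n hn => ?_)
    · rw [c1 _ (mono_mem_bdd _) (mono_mem_hardy hn),
        c1 _ (mono_mem_bdd _) (mono_mem_hardy (by omega)), map_add, hsm]
      simp only [mulL_toLinf_mono]
      rw [α.shiftPerp_mul (zpow_mem_hardy hn hh₁.1), zpow_zpow, zpow_zpow, add_comm 1 n]
    · rw [hc2 n hn, hsm, zpow_zpow, add_comm]
      rcases eq_or_lt_of_le (show n ≤ -1 by omega) with rfl | hn'
      · rw [θ.shiftPerp_mono_neg_one, hθ0, map_zero, zero_smul, map_zero, neg_add_cancel, zpow_zero,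
          projMinus_of_mem_hardy hψ₄.1]
      · rw [θ.shiftPerp_mono hn', hc2 _ (by omega)]

end DualTruncated

end

theorem mainTheorem2 (θ α : DualTruncated.InnerFunction)
    (hθ : θ.Nonconstant) (hα : α.Nonconstant)
    (D : θ.modelPerp →L[ℂ] α.modelPerp) :
    D ∘L θ.dualShift = α.dualShift ∘L D ↔
      ∃ ψ₁ ψ₂ ψ₃ ψ₄ : DualTruncated.L2,
        DualTruncated.HasBlockMatrix D ψ₁ ψ₂ ψ₃ ψ₄ ∧
        (θ.eval 0 ≠ 0 →
          ψ₁ = (conj (α.eval 0) / conj (θ.eval 0)) • α.mul (θ.mulConj ψ₄) ∧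
          ψ₂ = conj (α.eval 0) • α.mul (DualTruncated.projPlus ψ₄) ∧
          ψ₃ = (1 / conj (θ.eval 0)) • θ.mulConj (DualTruncated.projMinus ψ₄) ∧
          ψ₄ ∈ DualTruncated.bdd) ∧
        (θ.eval 0 = 0 → α.eval 0 ≠ 0 →
          ψ₁ ∈ DualTruncated.bdd ∧
          ψ₂ = 0 ∧
          ψ₃ = (1 / conj (α.eval 0)) •
            θ.mulConj (DualTruncated.projMinus (α.mulConj (θ.mul ψ₁))) ∧
          ψ₄ = 0) ∧
        (θ.eval 0 = 0 → α.eval 0 = 0 →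
          (∃ h ∈ DualTruncated.hardyInf, ψ₁ = α.mul (θ.mulConj h)) ∧
          ψ₂ = 0 ∧
          ψ₃ ∈ DualTruncated.bdd ∧
          ψ₄ ∈ DualTruncated.hardyInf) := by
  by_cases hθ0 : θ.eval 0 = 0
  · by_cases hα0 : α.eval 0 = 0
    · rw [DualTruncated.comp_dualShift_eq_iff_of_eval_eq_zero D hθ0 hα0]
      constructor
      · rintro ⟨h₁, hh₁, ψ₃, hψ₃, ψ₄, hψ₄, hB⟩
        exact ⟨_, _, _, _, hB, fun h => absurd hθ0 h, fun _ h => absurd hα0 h,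
          fun _ _ => ⟨⟨h₁, hh₁, rfl⟩, rfl, hψ₃, hψ₄⟩⟩
      · rintro ⟨_, _, ψ₃, ψ₄, hB, -, -, h⟩
        obtain ⟨⟨h₁, hh₁, rfl⟩, rfl, hψ₃, hψ₄⟩ := h hθ0 hα0
        exact ⟨h₁, hh₁, ψ₃, hψ₃, ψ₄, hψ₄, hB⟩
    · rw [DualTruncated.comp_dualShift_eq_iff_of_eval_eq_zero_of_ne_zero D hθ0 hα0]
      constructor
      · rintro ⟨ψ, hψ, hB⟩
        exact ⟨_, _, _, _, hB, fun h => absurd hθ0 h, fun _ _ => ⟨hψ, rfl, rfl, rfl⟩,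
          fun _ h => absurd h hα0⟩
      · rintro ⟨ψ, _, _, _, hB, -, h, -⟩
        obtain ⟨hψ, rfl, rfl, rfl⟩ := h hθ0 hα0
        exact ⟨ψ, hψ, hB⟩
  · rw [DualTruncated.comp_dualShift_eq_iff_of_eval_ne_zero D hθ0]
    constructor
    · rintro ⟨ψ, hψ, hB⟩
      exact ⟨_, _, _, _, hB, fun _ => ⟨rfl, rfl, rfl, hψ⟩, fun h => absurd h hθ0,
        fun h => absurd h hθ0⟩
    · rintro ⟨_, _, _, ψ, hB, h, -, -⟩
      obtain ⟨rfl, rfl, rfl, hψ⟩ := h hθ0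
      exact ⟨ψ, hψ, hB⟩
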